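/- For $n>1$ let $Z_1$ denote the observable on $n$ qubits which is the Pauli-$Z$ operator on the first qubit and the identity on the others. For $\delta>0$ let $\mathcal{S}_n(\delta)$ be the set of all $n$-qubit mixed states $\rho$ whose top eigenvector $|\phi\rangle$ has an eigenvalue that is larger than all the other eigenvalues of $\rho$ (counted with multiplicity) by at least $\delta$. We say that a learning algorithm, which receives copies of an unknown $n$-qubit state $\rho$ and outputs a real number, *solves the task with gap $\delta$* if for every $\rho\in\mathcal{S}_n(\delta)$ its output lies within $0.25$ of $\langle\phi|Z_1|\phi\rangle$ with probability at least $0.8$. An algorithm in the *quantum-enhanced* scenario using $T$ copies performs a joint POVM measurement (with finitely many outcomes) on $\rho^{\otimes T}$ and computes its output from the outcome. An algorithm in the *conventional* scenario using at most $T$ copies measures the copies of $\rho$ one at a time, each by a POVM (with finitely many outcomes) that may depend on all the earlier outcomes, and computes its output from the sequence of outcomes; that is, it is a decision tree of depth at most $T$. * **Upper bound.** For every constant $\delta>0$ there is a number $T$, depending only on $\delta$, such that for every $n>1$ there is an algorithm in the quantum-enhanced scenario that uses $T$ copies of $\rho$ and solves the task with gap $\delta$. That is, $\mathcal{O}(1)$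 copies suffice. * **Lower bound.** There is a universal constant $c>0$ such that for every constant $0<\delta<1/2$ there is an $n_0$ such that for all $n>1$ with $n\ge n_0$, every algorithm in the conventional scenario that uses at most $T$ copies of $\rho$ and solves the task with gap $\delta$ satisfies $T\ge c\,2^{n/2}$. That is, $\Omega(2^{n/2})$ copies are necessary. -/

import Mathlib

open scoped Matrix ComplexOrder

noncomputable section

namespace QPCA

/-- Labels of the computational basis of `n` qubits; an operator on `n` qubits is a matrix
`Matrix (Qubits n) (Qubits n) ℂ`, a state vector is a function `Qubits n → ℂ`. -/
abbrev Qubits (n : ℕ) : Type := Fin n → Fin 2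

/-- Density matrices (mixed states). -/
structure IsDensityMatrix {ι : Type} [Fintype ι] (ρ : Matrix ι ι ℂ) : Prop where
  posSemidef : ρ.PosSemidef
  trace_eq_one : ρ.trace = 1

/-- The unit vector `φ` is a top eigenvector of `ρ`, and its eigenvalue exceeds all the other
eigenvalues of `ρ`, counted with multiplicity, by at least `δ`. (For Hermitian `ρ` the other
eigenvalues are exactly those of the eigenvectors orthogonal to `φ`.) -/
def IsPrincipalComponent {ι : Type} [Fintype ι] (δ : ℝ) (ρ : Matrix ι ι ℂ) (φ : ι → ℂ) : Prop :=
  star φ ⬝ᵥ φ = 1 ∧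
    ∃ top : ℝ, ρ *ᵥ φ = (top : ℂ) • φ ∧
      ∀ (μ : ℝ) (v : ι → ℂ), v ≠ 0 → star φ ⬝ᵥ v = 0 → ρ *ᵥ v = (μ : ℂ) • v → μ + δ ≤ top

/-- The expectation value `⟨φ|O|φ⟩` of a Hermitian observable `O`. -/
def expectation {ι : Type} [Fintype ι] (O : Matrix ι ι ℂ) (φ : ι → ℂ) : ℝ :=
  (star φ ⬝ᵥ (O *ᵥ φ)).re

/-- The Pauli matrix `Z` acting on qubit `j` (and the identity on all other qubits): it multiplies
the basis state `|x⟩` by `1` if `x j = 0` and by `-1` if `x j = 1`. -/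
def pauliZ {n : ℕ} (j : Fin n) : Matrix (Qubits n) (Qubits n) ℂ :=
  Matrix.diagonal fun x => if x j = 0 then 1 else -1

/-- POVMs with `k` outcomes. -/
structure POVM (ι : Type) [Fintype ι] [DecidableEq ι] (k : ℕ) where
  effect : Fin k → Matrix ι ι ℂ
  posSemidef : ∀ s, (effect s).PosSemidef
  sum_eq_one : ∑ s, effect s = 1

/-- The probability `tr (F_s ρ)` of the outcome `s`. -/
def POVM.outcomeProb {ι : Type} [Fintype ι] [DecidableEq ι] {k : ℕ} (F : POVM ι k)
    (ρ : Matrix ι ι ℂ) (s : Fin k) : ℝ :=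
  (F.effect s * ρ).trace.re

/-- Learning algorithms in the conventional scenario that use at most `T` copies of the unknown
state: decision trees of depth at most `T`. At a `measure` node one fresh copy of the state is
measured by a POVM; the outcome decides which subtree is run next, so that every measurement may
depend on all earlier outcomes. At a `predict` node the algorithm stops and outputs a real number.
The number of outcomes is finite but arbitrary, so coins tossed by the algorithm can be made part
of the outcomes. -/
inductive ConventionalAlgorithm (ι : Type) [Fintype ι] [DecidableEq ι] : ℕ → Type
  | predict {T : ℕ} (y : ℝ) : ConventionalAlgorithm ι T
  | measure {T k : ℕ} (F : POVM ι k) (next : Fin k → ConventionalAlgorithm ι T) :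
      ConventionalAlgorithm ι (T + 1)

/-- The probability that the output of a conventional algorithm lies in `S` when the unknown state
is `ρ`. -/
def ConventionalAlgorithm.outputProb {ι : Type} [Fintype ι] [DecidableEq ι]
    (ρ : Matrix ι ι ℂ) (S : Set ℝ) : {T : ℕ} → ConventionalAlgorithm ι T → ℝ
  | _, .predict y => S.indicator (fun _ => 1) y
  | _, .measure F next => ∑ s, F.outcomeProb ρ s * outputProb ρ S (next s)

/-- The state `ρ^{⊗T}` of `T` copies of `ρ`. -/
def copies {ι : Type} (T : ℕ) (ρ : Matrix ι ι ℂ) : Matrix (Fin T → ι) (Fin T → ι) ℂ :=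
  Matrix.of fun x y => ∏ t, ρ (x t) (y t)

/-- Learning algorithms in the quantum-enhanced scenario that use `T` copies of the unknown state:
the copies are held in a quantum memory and processed jointly, at the end everything is measured,
and a real number is computed from the outcome. Quantum processing with any number of ancillas
followed by a measurement is the same thing as a POVM on the `T` copies. -/
structure QuantumEnhancedAlgorithm (ι : Type) [Fintype ι] [DecidableEq ι] (T : ℕ) where
  numOutcomes : ℕ
  povm : POVM (Fin T → ι) numOutcomes
  predict : Fin numOutcomes → ℝ

/-- The probability that the output of a quantum-enhanced algorithm lies in `S` when the unknown
state is `ρ`. -/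
def QuantumEnhancedAlgorithm.outputProb {ι : Type} [Fintype ι] [DecidableEq ι] {T : ℕ}
    (ρ : Matrix ι ι ℂ) (S : Set ℝ) (A : QuantumEnhancedAlgorithm ι T) : ℝ :=
  ∑ s, A.povm.outcomeProb (copies T ρ) s * S.indicator (fun _ => 1) (A.predict s)

/-- The principal component task with observable `O` and gap `δ`: `outputProb ρ S` being the
probability that the output lies in `S` when the unknown state is `ρ`, the output is within `0.25`
of `⟨φ|O|φ⟩` with probability at least `0.8`, for every state `ρ` whose top eigenvector `φ` has an
eigenvalue larger than all the others by at least `δ`. -/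
def PredictsPrincipalComponent {ι : Type} [Fintype ι] (O : Matrix ι ι ℂ) (δ : ℝ)
    (outputProb : Matrix ι ι ℂ → Set ℝ → ℝ) : Prop :=
  ∀ (ρ : Matrix ι ι ℂ) (φ : ι → ℂ), IsDensityMatrix ρ → IsPrincipalComponent δ ρ φ →
    0.8 ≤ outputProb ρ {y : ℝ | |y - expectation O φ| ≤ 0.25}

end QPCA

end

/-! Lower bound. Pick one of the two eigenspaces (sectors) of the Pauli operator, of dimension N =
2^(n-1). Hide a vector z in it: weight 1/2 on z, weight 1/2 spread evenly over the other sector. For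
unit z the top eigenvector is z, the gap is 1/2 - 2^(-n), and the expectation value is 1 or -1
according to the sector. Averaged over z, either family gives the maximally mixed state for a single
copy; what has to be bounded is the effect of T adaptive measurements on the same z.

The average is taken over a Gaussian z in ℂ^N, on which outcome probabilities are homogeneous: tr(F
ρ_z) is a sum of squared moduli of linear forms, so the product along a path of the decision tree is
a sum of squared moduli of holomorphic polynomials. In the Fock inner product multiplication by a
linear form a·z is adjoint to a derivative D_a, and the commutation relation gives ‖(a·z) p‖² = |a|²
‖p‖² + ‖D_a p‖² (`sum_sq_mul_integral_le`). Hence each measurement multiplies the integral by at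
least tr F / 2, which is N times the outcome probability on the maximally mixed state, whatever
happened before (`integral_homProb_mul_ge`). Comparison with the radial moment N(N+1)⋯(N+T) loses
only a factor 1 - O(T²/N). On the maximally mixed state the answers wrong for the first sector and
those wrong for the second have total probability at least 1, while success on both families would
make it about 2/5 unless T² is of order N.

Upper bound. A cyclic shift of K+1 copies, combined with the observable on one copy, has expectation
tr(O ρ^(K+1)) (`trace_shiftDiag_mul_copies`). With a gap, ρ^(K+1) is dominated by the principal
component once K is large in terms of δ (`exists_trace_diagonal_mul_pow`), so the ratio of tr(O
ρ^(K+1)) to tr(ρ^(K+1)) is close to ⟨φ|O|φ⟩. Both traces are estimated by averaging over a constant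
number of blocks, with Chebyshev's inequality. -/

namespace QPCA

open MeasureTheory MvPolynomial
open scoped ComplexConjugate Nat

/-! ### Moments of the complex Gaussian -/

/-- The standard complex Gaussian measure, with density `exp (-|z|²) / π`. -/
noncomputable def complexGaussian : Measure ℂ :=
  volume.withDensity fun z => ENNReal.ofReal (Real.exp (-‖z‖ ^ 2) / Real.pi)

lemma measurable_complexGaussian_density :
    Measurable fun z : ℂ => ENNReal.ofReal (Real.exp (-‖z‖ ^ 2) / Real.pi) := by
  fun_prop

lemma integral_complexGaussian (g : ℂ → ℂ) :
    ∫ z, g z ∂complexGaussian = ∫ z : ℂ, (Real.exp (-‖z‖ ^ 2) / Real.pi) • g z := by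
  rw [complexGaussian, integral_withDensity_eq_integral_toReal_smul
    measurable_complexGaussian_density (by simp)]
  congr 1; ext z
  rw [ENNReal.toReal_ofReal (by positivity)]

lemma integral_norm_pow_mul_exp (j : ℕ) :
    ∫ z : ℂ, ‖z‖ ^ (2 * j) * Real.exp (-‖z‖ ^ 2) = Real.pi * j ! := by
  have h := Complex.integral_rpow_mul_exp_neg_rpow (p := 2) (q := (2 * j : ℕ)) (by norm_num)
    (by have : (0 : ℝ) ≤ ((2 * j : ℕ) : ℝ) := by positivity
        linarith)
  have h2 : (((2 * j : ℕ) : ℝ) + 2) / 2 = (j : ℝ) + 1 := by push_cast; ring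
  rw [h2, Real.Gamma_nat_eq_factorial] at h
  simp only [Real.rpow_natCast] at h
  rw [show (2 : ℝ) = ((2 : ℕ) : ℝ) by norm_num] at h
  simp only [Real.rpow_natCast] at h
  rw [h]; push_cast; ring

lemma integrable_norm_pow_mul_exp (j : ℕ) :
    Integrable fun z : ℂ => ‖z‖ ^ (2 * j) * Real.exp (-‖z‖ ^ 2) := by
  apply Integrable.of_integral_ne_zero
  rw [integral_norm_pow_mul_exp]
  have := Real.pi_pos
  positivity

lemma integrable_pow_mul_conj_pow (j k : ℕ) :
    Integrable (fun z : ℂ => z ^ j * conj z ^ k) complexGaussian := by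
  rw [complexGaussian, integrable_withDensity_iff_integrable_smul'
    measurable_complexGaussian_density (by simp)]
  have h := (((integrable_norm_pow_mul_exp j).add (integrable_norm_pow_mul_exp k)).const_mul
    Real.pi⁻¹)
  refine h.mono' (Measurable.aestronglyMeasurable (by fun_prop)) (Filter.Eventually.of_forall fun z => ?_)
  have hpi := Real.pi_pos
  rw [ENNReal.toReal_ofReal (by positivity), norm_smul, norm_mul, norm_pow, norm_pow,
    RCLike.norm_conj, Real.norm_of_nonneg (by positivity)]
  simp only [Pi.add_apply]
  have h3 : ‖z‖ ^ j * ‖z‖ ^ k ≤ ‖z‖ ^ (2 * j) + ‖z‖ ^ (2 * k) := by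
    rw [pow_mul', pow_mul']
    nlinarith [sq_nonneg (‖z‖ ^ j - ‖z‖ ^ k), sq_nonneg (‖z‖ ^ j), sq_nonneg (‖z‖ ^ k)]
  rw [← add_mul, div_mul_eq_mul_div, div_eq_inv_mul]
  have h4 := Real.exp_pos (-‖z‖ ^ 2)
  have h5 := mul_le_mul_of_nonneg_left h3 h4.le
  have h6 : 0 ≤ Real.pi⁻¹ := by positivity
  have h7 := mul_le_mul_of_nonneg_left h5 h6
  linarith

lemma integral_pow_mul_conj_pow_self (j : ℕ) :
    ∫ z, z ^ j * conj z ^ j ∂complexGaussian = (j ! : ℂ) := by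
  rw [integral_complexGaussian]
  have h : ∀ z : ℂ, (Real.exp (-‖z‖ ^ 2) / Real.pi) • (z ^ j * conj z ^ j) =
      ((Real.pi⁻¹ * (‖z‖ ^ (2 * j) * Real.exp (-‖z‖ ^ 2)) : ℝ) : ℂ) := by
    intro z
    rw [← mul_pow, Complex.mul_conj, Complex.normSq_eq_norm_sq, Complex.real_smul, pow_mul]
    push_cast; ring
  simp_rw [h]
  rw [integral_complex_ofReal, integral_const_mul, integral_norm_pow_mul_exp,
    inv_mul_cancel_left₀ Real.pi_pos.ne']
  simp

/-- Rotation by one radian works for all exponents at once: exp(i(j - k)) = 1 with j ≠ k would make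
π rational. -/
lemma exists_unit_pow_mul_conj_pow_ne_one {j k : ℕ} (h : j ≠ k) :
    ∃ c : Circle, (c : ℂ) ^ j * conj (c : ℂ) ^ k ≠ 1 := by
  refine ⟨Circle.exp 1, fun hc => h ?_⟩
  rw [Circle.coe_exp, ← Complex.exp_conj, ← Complex.exp_nat_mul, ← Complex.exp_nat_mul,
    ← Complex.exp_add, Complex.exp_eq_one_iff] at hc
  obtain ⟨n, hn⟩ := hc
  have h1 := congrArg Complex.im hn
  simp at h1
  by_cases hn0 : n = 0
  · simp [hn0] at h1
    have : (j : ℝ) = k := by linarith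
    exact_mod_cast this
  · exfalso
    have hirr : Irrational (n * (2 * Real.pi)) := by
      have := (irrational_pi.natCast_mul (m := 2) (by norm_num)).intCast_mul hn0
      simpa using this
    rw [← h1] at hirr
    exact hirr ⟨(j : ℚ) - k, by push_cast; ring⟩

/-- The measure is rotation invariant, while a rotation multiplies the integrand by a constant
different from 1. -/
lemma integral_pow_mul_conj_pow_of_ne {j k : ℕ} (h : j ≠ k) :
    ∫ z, z ^ j * conj z ^ k ∂complexGaussian = 0 := by
  obtain ⟨c, hc⟩ := exists_unit_pow_mul_conj_pow_ne_one h
  rw [integral_complexGaussian]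
  set F : ℂ → ℂ := fun z => (Real.exp (-‖z‖ ^ 2) / Real.pi) • (z ^ j * conj z ^ k) with hF
  have h1 : ∫ z, F (rotation c z) = ∫ z, F z :=
    (rotation c).measurePreserving.integral_comp
      (rotation c).toHomeomorph.measurableEmbedding F
  have h2 : ∀ z, F (rotation c z) = ((c : ℂ) ^ j * conj (c : ℂ) ^ k) * F z := by
    intro z
    simp only [hF, rotation_apply, norm_mul, Circle.norm_coe, one_mul, map_mul,
      Complex.real_smul, mul_pow]
    ring
  simp_rw [h2] at h1
  rw [integral_const_mul] at h1
  by_contra h0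
  exact hc (mul_right_cancel₀ h0 (by rw [h1, one_mul]))

instance : IsProbabilityMeasure complexGaussian := by
  have h : ∫ z, (1 : ℂ) ∂complexGaussian = 1 := by
    simpa using integral_pow_mul_conj_pow_self 0
  refine ⟨?_⟩
  rw [integral_const] at h
  simp only [Complex.real_smul, mul_one] at h
  have h2 : complexGaussian.real Set.univ = 1 := by exact_mod_cast h
  rw [Measure.real] at h2
  exact (ENNReal.toReal_eq_one_iff _).1 h2

variable {κ : Type} [Fintype κ]

/-- The standard Gaussian measure on `ℂ^κ`. -/
noncomputable def gaussianVector (κ : Type) [Fintype κ] : Measure (κ → ℂ) :=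
  Measure.pi fun _ => complexGaussian

instance : IsProbabilityMeasure (gaussianVector κ) := by
  unfold gaussianVector; infer_instance

/-! ### The Fock inner product on polynomials -/

/-- The Fock (Bargmann) inner product of two polynomials. -/
noncomputable def fock (p q : MvPolynomial κ ℂ) : ℂ :=
  ∫ z, eval z p * conj (eval z q) ∂gaussianVector κ

lemma eval_monomial_mul_conj (α β : κ →₀ ℕ) (a b : ℂ) (z : κ → ℂ) :
    eval z (monomial α a) * conj (eval z (monomial β b)) =
      (a * conj b) * ∏ i, (z i ^ α i * conj (z i) ^ β i) := by
  rw [eval_monomial, eval_monomial, Finsupp.prod_fintype _ _ (by simp),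
    Finsupp.prod_fintype _ _ (by simp), map_mul, map_prod, Finset.prod_mul_distrib]
  simp only [map_pow]
  ring

lemma integrable_eval_mul_conj_eval (p q : MvPolynomial κ ℂ) :
    Integrable (fun z => eval z p * conj (eval z q)) (gaussianVector κ) := by
  induction p using MvPolynomial.induction_on' with
  | monomial α a =>
    induction q using MvPolynomial.induction_on' with
    | monomial β b =>
      simp_rw [eval_monomial_mul_conj]
      exact (Integrable.fintype_prod fun i => integrable_pow_mul_conj_pow _ _).const_mul _
    | add p q hp hq =>
      simp_rw [map_add, mul_add]
      exact hp.add hq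
  | add p q hp hq =>
    simp_rw [map_add, add_mul]
    exact hp.add hq

lemma fock_add_left (p p' q : MvPolynomial κ ℂ) : fock (p + p') q = fock p q + fock p' q := by
  simp_rw [fock, map_add, add_mul]
  exact integral_add (integrable_eval_mul_conj_eval _ _) (integrable_eval_mul_conj_eval _ _)

lemma fock_C_mul_left (c : ℂ) (p q : MvPolynomial κ ℂ) : fock (C c * p) q = c * fock p q := by
  simp_rw [fock, map_mul, eval_C, mul_assoc]
  exact integral_const_mul _ _

lemma conj_fock (p q : MvPolynomial κ ℂ) : conj (fock p q) = fock q p := by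
  rw [fock, fock, ← integral_conj]
  congr 1; ext z
  simp [mul_comm]

lemma fock_add_right (p q q' : MvPolynomial κ ℂ) : fock p (q + q') = fock p q + fock p q' := by
  rw [← conj_fock, fock_add_left, map_add, conj_fock, conj_fock]

lemma fock_C_mul_right (c : ℂ) (p q : MvPolynomial κ ℂ) :
    fock p (C c * q) = conj c * fock p q := by
  rw [← conj_fock, fock_C_mul_left, map_mul, conj_fock]

lemma fock_zero_left (q : MvPolynomial κ ℂ) : fock 0 q = 0 := by simp [fock]

lemma fock_sum_left {J : Type} (s : Finset J) (f : J → MvPolynomial κ ℂ) (q : MvPolynomial κ ℂ) :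
    fock (∑ j ∈ s, f j) q = ∑ j ∈ s, fock (f j) q := by
  classical
  induction s using Finset.induction_on with
  | empty => simp [fock_zero_left]
  | insert a s ha ih => rw [Finset.sum_insert ha, Finset.sum_insert ha, fock_add_left, ih]

lemma fock_sum_right {J : Type} (s : Finset J) (f : J → MvPolynomial κ ℂ) (q : MvPolynomial κ ℂ) :
    fock q (∑ j ∈ s, f j) = ∑ j ∈ s, fock q (f j) := by
  rw [← conj_fock, fock_sum_left, map_sum]
  simp_rw [conj_fock]

lemma fock_monomial_self (α : κ →₀ ℕ) (a b : ℂ) :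
    fock (monomial α a) (monomial α b) = a * conj b * ∏ i, ((α i)! : ℂ) := by
  simp_rw [fock, eval_monomial_mul_conj]
  rw [integral_const_mul, gaussianVector,
    integral_fintype_prod_eq_prod (fun i (z : ℂ) => z ^ α i * conj z ^ α i)]
  simp_rw [integral_pow_mul_conj_pow_self]

lemma fock_monomial_of_ne {α β : κ →₀ ℕ} (h : α ≠ β) (a b : ℂ) :
    fock (monomial α a) (monomial β b) = 0 := by
  simp_rw [fock, eval_monomial_mul_conj]
  rw [integral_const_mul, gaussianVector,
    integral_fintype_prod_eq_prod (fun i (z : ℂ) => z ^ α i * conj z ^ β i)]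
  obtain ⟨i, hi⟩ := Finsupp.ne_iff.1 h
  rw [Finset.prod_eq_zero (Finset.mem_univ i) (integral_pow_mul_conj_pow_of_ne hi), mul_zero]

/-- Multiplication by a variable is adjoint to differentiation. -/
lemma fock_X_mul_right (i : κ) (p q : MvPolynomial κ ℂ) :
    fock p (X i * q) = fock (pderiv i p) q := by
  classical
  induction p using MvPolynomial.induction_on' with
  | add p p' hp hp' => rw [fock_add_left, hp, hp', map_add, fock_add_left]
  | monomial α a =>
    induction q using MvPolynomial.induction_on' with
    | add q q' hq hq' => rw [mul_add, fock_add_right, hq, hq', fock_add_right]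
    | monomial β b =>
      rw [pderiv_monomial, X, monomial_mul, one_mul]
      -- Monomials are orthogonal, so only this case gives a nonzero value: α! on one side, α i * β!
      -- on the other.
      by_cases h : α = Finsupp.single i 1 + β
      · subst h
        rw [fock_monomial_self, add_tsub_cancel_left, fock_monomial_self,
          ← Finset.mul_prod_erase _ _ (Finset.mem_univ i),
          ← Finset.mul_prod_erase _ (fun j => ((β j)! : ℂ)) (Finset.mem_univ i)]
        have h1 : ∏ j ∈ Finset.univ.erase i, ((((Finsupp.single i 1 + β : κ →₀ ℕ) j)! : ℕ) : ℂ) =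
            ∏ j ∈ Finset.univ.erase i, ((β j)! : ℂ) := by
          refine Finset.prod_congr rfl fun j hj => ?_
          have : i ≠ j := (Finset.ne_of_mem_erase hj).symm
          simp [this]
        rw [h1]
        simp only [Finsupp.add_apply, Finsupp.single_eq_same]
        rw [add_comm 1 (β i), Nat.factorial_succ]
        push_cast; ring
      · rw [fock_monomial_of_ne h]
        -- Truncated subtraction makes the exponent of the derivative meaningless when `α i = 0`,
        -- but then its coefficient vanishes.
        by_cases hi : α i = 0
        · simp [hi, fock_zero_left]
        · rw [fock_monomial_of_ne]
          intro h'
          apply h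
          rw [← h', add_tsub_cancel_of_le]
          simpa [Nat.one_le_iff_ne_zero] using hi

/-- The linear form `z ↦ ∑ a i z i`. -/
noncomputable def linForm (a : κ → ℂ) : MvPolynomial κ ℂ := ∑ i, C (a i) * X i

lemma linForm_isHomogeneous (a : κ → ℂ) : (linForm a).IsHomogeneous 1 :=
  IsHomogeneous.sum _ _ _ fun i _ => by
    simpa using (isHomogeneous_C κ (a i)).mul (isHomogeneous_X ℂ i)

lemma eval_linForm (a z : κ → ℂ) : eval z (linForm a) = ∑ i, a i * z i := by
  simp [linForm]

lemma fock_linForm_mul_right (a : κ → ℂ) (p q : MvPolynomial κ ℂ) :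
    fock p (linForm a * q) = fock (∑ i, C (conj (a i)) * pderiv i p) q := by
  rw [linForm, Finset.sum_mul, fock_sum_right, fock_sum_left]
  refine Finset.sum_congr rfl fun i _ => ?_
  rw [mul_assoc, fock_C_mul_right, fock_C_mul_left, fock_X_mul_right]

lemma fock_self_eq (p : MvPolynomial κ ℂ) :
    fock p p = ((∫ z, ‖eval z p‖ ^ 2 ∂gaussianVector κ : ℝ) : ℂ) := by
  rw [fock, ← integral_complex_ofReal]
  congr 1; ext z
  rw [Complex.mul_conj, Complex.normSq_eq_norm_sq]

lemma integrable_norm_eval_sq (p : MvPolynomial κ ℂ) :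
    Integrable (fun z => ‖eval z p‖ ^ 2) (gaussianVector κ) := by
  have h := (integrable_eval_mul_conj_eval p p).re
  refine h.congr (Filter.Eventually.of_forall fun z => ?_)
  simp only [Complex.mul_conj, Complex.normSq_eq_norm_sq]
  exact Complex.ofReal_re _

lemma pderiv_linForm (a : κ → ℂ) (i : κ) : pderiv i (linForm a) = C (a i) := by
  classical
  simp only [linForm, map_sum, pderiv_C_mul, pderiv_X]
  rw [Finset.sum_eq_single i]
  · simp
  · intro j _ hj; simp [hj]
  · simp

/-- With D the adjoint of multiplication by a, the Leibniz rule reads D(a p) = |a|² p + a (D p).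
Pairing with p gives ‖a p‖² = |a|² ‖p‖² + ‖D p‖², and the last term is dropped. -/
lemma sum_sq_mul_integral_le (a : κ → ℂ) (p : MvPolynomial κ ℂ) :
    (∑ i, ‖a i‖ ^ 2) * ∫ z, ‖eval z p‖ ^ 2 ∂gaussianVector κ ≤
      ∫ z, ‖eval z (linForm a * p)‖ ^ 2 ∂gaussianVector κ := by
  set Dp : MvPolynomial κ ℂ := ∑ i, C (conj (a i)) * pderiv i p with hDp
  have h1 : ∑ i, C (conj (a i)) * pderiv i (linForm a * p) =
      C ((∑ i, ‖a i‖ ^ 2 : ℝ) : ℂ) * p + linForm a * Dp := by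
    have hC : C ((∑ i, ‖a i‖ ^ 2 : ℝ) : ℂ) = ∑ i, C (conj (a i)) * (C (a i) : MvPolynomial κ ℂ) := by
      rw [Complex.ofReal_sum, map_sum]
      refine Finset.sum_congr rfl fun i _ => ?_
      rw [← C_mul, mul_comm (conj _), Complex.mul_conj, Complex.normSq_eq_norm_sq]
    rw [hC, hDp, Finset.sum_mul, Finset.mul_sum, ← Finset.sum_add_distrib]
    refine Finset.sum_congr rfl fun i _ => ?_
    rw [pderiv_mul, pderiv_linForm]
    ring
  have h2 : fock (linForm a * p) (linForm a * p) =
      ((∑ i, ‖a i‖ ^ 2 : ℝ) : ℂ) * fock p p + fock Dp Dp := by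
    rw [fock_linForm_mul_right, h1, fock_add_left, fock_C_mul_left, ← conj_fock p (linForm a * Dp),
      fock_linForm_mul_right, conj_fock]
  rw [fock_self_eq, fock_self_eq, fock_self_eq] at h2
  have h3 : 0 ≤ ∫ z, ‖eval z Dp‖ ^ 2 ∂gaussianVector κ :=
    integral_nonneg fun z => by positivity
  have h4 : ∫ z, ‖eval z (linForm a * p)‖ ^ 2 ∂gaussianVector κ =
      (∑ i, ‖a i‖ ^ 2) * ∫ z, ‖eval z p‖ ^ 2 ∂gaussianVector κ +
        ∫ z, ‖eval z Dp‖ ^ 2 ∂gaussianVector κ := by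
    exact_mod_cast h2
  linarith

/-- By adjointness the left side is the pairing of ∑ ∂_i(z_i p) with p; Euler's identity for
homogeneous p evaluates this sum as (N + d) p, N being the number of variables. -/
lemma sum_integral_X_mul {d : ℕ} {p : MvPolynomial κ ℂ} (hp : p.IsHomogeneous d) :
    ∑ i, ∫ z, ‖eval z (X i * p)‖ ^ 2 ∂gaussianVector κ =
      (Fintype.card κ + d) * ∫ z, ‖eval z p‖ ^ 2 ∂gaussianVector κ := by
  have h : ∑ i, fock (X i * p) (X i * p) = (Fintype.card κ + d) * fock p p := by
    simp_rw [fock_X_mul_right, pderiv_mul, pderiv_X_self, one_mul, fock_add_left]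
    rw [Finset.sum_add_distrib, ← fock_sum_left Finset.univ fun i => X i * pderiv i p, hp.sum_X_mul_pderiv, nsmul_eq_mul,
      ← C_eq_coe_nat, fock_C_mul_left]
    simp only [Finset.sum_const, Finset.card_univ, nsmul_eq_mul]
    ring
  simp_rw [fock_self_eq] at h
  exact_mod_cast h

end QPCA

namespace QPCA

open MeasureTheory MvPolynomial
open scoped ComplexConjugate Nat

variable {κ : Type} [Fintype κ]

/-! ### The cone of sums of squared moduli -/

/-- The squared Euclidean norm of a vector in `ℂ^κ`. -/
noncomputable def normSq (z : κ → ℂ) : ℝ := ∑ i, ‖z i‖ ^ 2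

lemma normSq_nonneg (z : κ → ℂ) : 0 ≤ normSq z := Finset.sum_nonneg fun _ _ => by positivity

/-- Sums of squared moduli of homogeneous holomorphic polynomials of degree `d`. -/
def sosCone (κ : Type) [Fintype κ] (d : ℕ) : AddSubmonoid ((κ → ℂ) → ℝ) :=
  AddSubmonoid.closure
    {G | ∃ p : MvPolynomial κ ℂ, p.IsHomogeneous d ∧ G = fun z => ‖eval z p‖ ^ 2}

variable {d : ℕ} {G : (κ → ℂ) → ℝ}

lemma sosCone_nonneg (hG : G ∈ sosCone κ d) (z : κ → ℂ) : 0 ≤ G z := by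
  induction hG using AddSubmonoid.closure_induction with
  | mem G h => obtain ⟨p, -, rfl⟩ := h; positivity
  | zero => exact le_rfl
  | add G H _ _ hG hH => exact add_nonneg hG hH

lemma integrable_of_mem_sosCone (hG : G ∈ sosCone κ d) : Integrable G (gaussianVector κ) := by
  induction hG using AddSubmonoid.closure_induction with
  | mem G h => obtain ⟨p, -, rfl⟩ := h; exact integrable_norm_eval_sq p
  | zero => exact integrable_zero _ _ _
  | add G H _ _ hG hH => exact hG.add hH

lemma one_mem_sosCone : (fun _ => 1) ∈ sosCone κ 0 :=
  AddSubmonoid.subset_closure ⟨1, isHomogeneous_one κ ℂ, by simp⟩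

lemma norm_linForm_sq_mul_mem_sosCone (a : κ → ℂ) (hG : G ∈ sosCone κ d) :
    (fun z => ‖∑ i, a i * z i‖ ^ 2 * G z) ∈ sosCone κ (d + 1) := by
  induction hG using AddSubmonoid.closure_induction with
  | mem G h =>
    obtain ⟨p, hp, rfl⟩ := h
    refine AddSubmonoid.subset_closure ⟨linForm a * p, ?_, ?_⟩
    · rw [add_comm]; exact (linForm_isHomogeneous a).mul hp
    · ext z; rw [map_mul, eval_linForm, norm_mul, mul_pow]
  | zero =>
    convert (sosCone κ (d + 1)).zero_mem using 1
    ext z; simp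
  | add G H _ _ hG hH =>
    convert (sosCone κ (d + 1)).add_mem hG hH using 1
    ext z; simp [mul_add]

lemma integral_norm_linForm_sq_mul_ge (a : κ → ℂ) (hG : G ∈ sosCone κ d) :
    normSq a * ∫ z, G z ∂gaussianVector κ ≤
      ∫ z, ‖∑ i, a i * z i‖ ^ 2 * G z ∂gaussianVector κ := by
  induction hG using AddSubmonoid.closure_induction with
  | mem G h =>
    obtain ⟨p, hp, rfl⟩ := h
    simpa [normSq, eval_linForm, mul_pow] using sum_sq_mul_integral_le a p
  | zero => simp
  | add G H hG hH ihG ihH =>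
    simp only [Pi.add_apply, mul_add]
    rw [integral_add (integrable_of_mem_sosCone hG) (integrable_of_mem_sosCone hH),
      integral_add (integrable_of_mem_sosCone (norm_linForm_sq_mul_mem_sosCone a hG))
        (integrable_of_mem_sosCone (norm_linForm_sq_mul_mem_sosCone a hH))]
    linarith

lemma const_mul_mem_sosCone {c : ℝ} (hc : 0 ≤ c) (hG : G ∈ sosCone κ d) :
    (fun z => c * G z) ∈ sosCone κ d := by
  induction hG using AddSubmonoid.closure_induction with
  | mem G h =>
    obtain ⟨p, hp, rfl⟩ := h
    refine AddSubmonoid.subset_closure ⟨C ((√c : ℝ) : ℂ) * p, ?_, ?_⟩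
    · simpa using (isHomogeneous_C κ _).mul hp
    · ext z
      rw [map_mul, eval_C, norm_mul, mul_pow, Complex.norm_real, Real.norm_eq_abs, sq_abs,
        Real.sq_sqrt hc]
  | zero =>
    convert (sosCone κ d).zero_mem using 1
    ext z; simp
  | add G H _ _ hG hH =>
    convert (sosCone κ d).add_mem hG hH using 1
    ext z; simp [mul_add]

lemma sum_mem_sosCone {J : Type} (s : Finset J) {H : J → (κ → ℂ) → ℝ}
    (h : ∀ j ∈ s, H j ∈ sosCone κ d) : (fun z => ∑ j ∈ s, H j z) ∈ sosCone κ d := by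
  convert (sosCone κ d).sum_mem h using 1
  ext z; simp

lemma norm_coord_sq_mul_mem_sosCone (i : κ) (hG : G ∈ sosCone κ d) :
    (fun z => ‖z i‖ ^ 2 * G z) ∈ sosCone κ (d + 1) := by
  classical
  simpa [Pi.single_apply] using norm_linForm_sq_mul_mem_sosCone (Pi.single i 1) hG

lemma normSq_mul_mem_sosCone (hG : G ∈ sosCone κ d) :
    (fun z => normSq z * G z) ∈ sosCone κ (d + 1) := by
  simp_rw [normSq, Finset.sum_mul]
  exact sum_mem_sosCone _ fun i _ => norm_coord_sq_mul_mem_sosCone i hG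

lemma normSq_pow_mul_mem_sosCone (k : ℕ) (hG : G ∈ sosCone κ d) :
    (fun z => normSq z ^ k * G z) ∈ sosCone κ (d + k) := by
  induction k with
  | zero => simpa using hG
  | succ k ih =>
    simp_rw [pow_succ', mul_assoc]
    exact normSq_mul_mem_sosCone ih

lemma integral_normSq_mul (hG : G ∈ sosCone κ d) :
    ∫ z, normSq z * G z ∂gaussianVector κ =
      (Fintype.card κ + d) * ∫ z, G z ∂gaussianVector κ := by
  induction hG using AddSubmonoid.closure_induction with
  | mem G h =>
    obtain ⟨p, hp, rfl⟩ := h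
    rw [← sum_integral_X_mul hp, ← integral_finsetSum _ fun i _ => integrable_norm_eval_sq _]
    congr 1; ext z
    simp [normSq, Finset.sum_mul, mul_pow]
  | zero => simp
  | add G H hG hH ihG ihH =>
    simp only [Pi.add_apply, mul_add]
    rw [integral_add (integrable_of_mem_sosCone hG) (integrable_of_mem_sosCone hH),
      integral_add (integrable_of_mem_sosCone (normSq_mul_mem_sosCone hG))
        (integrable_of_mem_sosCone (normSq_mul_mem_sosCone hH)), ihG, ihH]
    ring

lemma integral_normSq_mul_ge (hG : G ∈ sosCone κ d) :
    Fintype.card κ * ∫ z, G z ∂gaussianVector κ ≤ ∫ z, normSq z * G z ∂gaussianVector κ := by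
  rw [integral_normSq_mul hG]
  have : 0 ≤ ∫ z, G z ∂gaussianVector κ := integral_nonneg (sosCone_nonneg hG)
  have hd : (0 : ℝ) ≤ d := by positivity
  nlinarith

lemma integral_normSq_pow_mul_ge (k : ℕ) (hG : G ∈ sosCone κ d) :
    (Fintype.card κ : ℝ) ^ k * ∫ z, G z ∂gaussianVector κ ≤
      ∫ z, normSq z ^ k * G z ∂gaussianVector κ := by
  induction k with
  | zero => simp
  | succ k ih =>
    have h := integral_normSq_mul_ge (normSq_pow_mul_mem_sosCone k hG)
    simp_rw [← mul_assoc, ← pow_succ'] at h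
    rw [pow_succ', mul_assoc]
    exact (mul_le_mul_of_nonneg_left ih (by positivity)).trans h

lemma normSq_pow_mem_sosCone (k : ℕ) : (fun z : κ → ℂ => normSq z ^ k) ∈ sosCone κ k := by
  simpa using normSq_pow_mul_mem_sosCone k one_mem_sosCone

lemma integral_normSq_pow (k : ℕ) :
    ∫ z : κ → ℂ, normSq z ^ k ∂gaussianVector κ =
      ∏ i ∈ Finset.range k, ((Fintype.card κ : ℝ) + i) := by
  induction k with
  | zero => simp
  | succ k ih =>
    rw [Finset.prod_range_succ, ← ih, mul_comm, ← integral_normSq_mul (normSq_pow_mem_sosCone k)]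
    simp_rw [pow_succ']

/-- This is ∏ (1 + i/N)⁻¹ ≥ 1 - ∑ i/N cleared of denominators, so that it also holds when the second
factor is negative. -/
lemma prod_range_add_mul_le {N : ℝ} (hN : 0 ≤ N) (k : ℕ) :
    (∏ i ∈ Finset.range k, (N + i)) * (2 * N - k * (k - 1)) ≤ 2 * N * N ^ k := by
  induction k with
  | zero => simp
  | succ k ih =>
    have hQ : 0 ≤ ∏ i ∈ Finset.range k, (N + i) := Finset.prod_nonneg fun i _ => by positivity
    set Q := ∏ i ∈ Finset.range k, (N + i)
    rw [Finset.prod_range_succ, pow_succ]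
    have h1 := mul_le_mul_of_nonneg_right ih hN
    -- Exactly the term lost in the step: (N + k)(2N - (k+1)k) = N(2N - k(k-1)) - k³ - k².
    have h2 : 0 ≤ Q * ((k : ℝ) ^ 3 + k ^ 2) := by positivity
    push_cast
    nlinarith

/-! ### States hiding a vector in one sector, balanced by the maximally mixed other sector -/

section Hidden

variable {ι : Type} [Fintype ι] [DecidableEq ι] (s : ι → Prop) [DecidablePred s]

/-- Extension of a vector by zero. -/
def extendVec (z : {x // s x} → ℂ) (x : ι) : ℂ := if h : s x then z ⟨x, h⟩ else 0

/-- The state `|z⟩⟨z| / 2` in the sector `s` plus a multiple of the identity in the other sector,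
homogeneous in `z`. -/
noncomputable def hiddenState (z : {x // s x} → ℂ) : Matrix ι ι ℂ :=
  (1 / 2 : ℂ) • Matrix.vecMulVec (extendVec s z) (star (extendVec s z)) +
    ((normSq z / (2 * Fintype.card {x // s x}) : ℝ) : ℂ) •
      Matrix.diagonal fun x => if s x then 0 else 1

omit [DecidableEq ι] in
lemma sum_mul_extendVec (a : ι → ℂ) (z : {x // s x} → ℂ) :
    ∑ x, a x * extendVec s z x = ∑ x : {x // s x}, a x * z x := by
  rw [← Fintype.sum_subtype_add_sum_subtype s]
  have h1 : ∀ x : {x // s x}, extendVec s z x = z x := fun x => by simp [extendVec, x.2]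
  have h2 : ∀ x : {x // ¬ s x}, extendVec s z x = 0 := fun x => by simp [extendVec, x.2]
  simp [h1, h2]

/-- Factoring an effect as `Bᴴ * B` exhibits its outcome probability as squared linear forms, one
per row of `B`, plus a nonnegative multiple of `normSq z`. This is what keeps probabilities in the
cone. -/
lemma trace_mul_hiddenState (B : Matrix ι ι ℂ) (z : {x // s x} → ℂ) :
    (Bᴴ * B * hiddenState s z).trace.re =
      1 / 2 * ∑ k, ‖∑ x : {x // s x}, B k x * z x‖ ^ 2 +
        normSq z / (2 * Fintype.card {x // s x}) * ∑ x : {x // ¬ s x}, ((Bᴴ * B) x x).re := by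
  have h1 : (Bᴴ * B * Matrix.vecMulVec (extendVec s z) (star (extendVec s z))).trace =
      ((∑ k, ‖∑ x : {x // s x}, B k x * z x‖ ^ 2 : ℝ) : ℂ) := by
    rw [Matrix.mul_vecMulVec, Matrix.trace_vecMulVec, ← Matrix.mulVec_mulVec, dotProduct_comm,
      Matrix.dotProduct_mulVec, ← Matrix.star_mulVec, Complex.ofReal_sum]
    simp only [dotProduct, Pi.star_apply, Matrix.mulVec, sum_mul_extendVec]
    refine Finset.sum_congr rfl fun k _ => ?_
    rw [mul_comm, RCLike.star_def, Complex.mul_conj, Complex.normSq_eq_norm_sq]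
  have h2 : (Bᴴ * B * Matrix.diagonal fun x => if s x then (0 : ℂ) else 1).trace.re =
      ∑ x : {x // ¬ s x}, ((Bᴴ * B) x x).re := by
    simp only [Matrix.trace, Matrix.diag_apply, Matrix.mul_diagonal, Complex.re_sum]
    rw [← Fintype.sum_subtype_add_sum_subtype s]
    have h3 : ∀ x : {x // s x}, ((Bᴴ * B) x x * if s x then (0 : ℂ) else 1) = 0 :=
      fun x => by simp [x.2]
    have h4 : ∀ x : {x // ¬ s x}, ((Bᴴ * B) x x * if s x then (0 : ℂ) else 1) = (Bᴴ * B) x x :=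
      fun x => by simp [x.2]
    simp only [h3, h4, Complex.zero_re, Finset.sum_const_zero, zero_add]
  rw [hiddenState, Matrix.mul_add, Matrix.mul_smul, Matrix.mul_smul, Matrix.trace_add,
    Matrix.trace_smul, Matrix.trace_smul, h1, smul_eq_mul, smul_eq_mul, Complex.add_re,
    Complex.re_ofReal_mul, h2,
    show (1 / 2 : ℂ) = ((1 / 2 : ℝ) : ℂ) by norm_num, Complex.re_ofReal_mul, Complex.ofReal_re]

omit [DecidableEq ι] in
lemma re_trace_conjTranspose_mul_self (B : Matrix ι ι ℂ) :
    (Bᴴ * B).trace.re = ∑ k, normSq (fun x : {x // s x} => B k x) +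
      ∑ x : {x // ¬ s x}, ((Bᴴ * B) x x).re := by
  simp only [Matrix.trace, Matrix.diag_apply, Complex.re_sum]
  rw [← Fintype.sum_subtype_add_sum_subtype s]
  congr 1
  simp only [normSq]
  rw [Finset.sum_comm]
  refine Finset.sum_congr rfl fun x _ => ?_
  rw [Matrix.mul_apply, Complex.re_sum]
  refine Finset.sum_congr rfl fun k _ => ?_
  rw [Matrix.conjTranspose_apply, mul_comm, RCLike.star_def, Complex.mul_conj,
    Complex.normSq_eq_norm_sq, Complex.ofReal_re]

omit [DecidableEq ι] in
lemma re_diag_conjTranspose_mul_self_nonneg (B : Matrix ι ι ℂ) (x : ι) :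
    0 ≤ ((Bᴴ * B) x x).re :=
  (Complex.le_def.1 ((Matrix.posSemidef_conjTranspose_mul_self B).diag_nonneg (i := x))).1

variable {s} {G : ({x // s x} → ℂ) → ℝ} {F : Matrix ι ι ℂ}

lemma exists_eq_conjTranspose_mul_self (hF : F.PosSemidef) : ∃ B : Matrix ι ι ℂ, F = Bᴴ * B := by
  open scoped MatrixOrder in
  obtain ⟨B, hB⟩ := CStarAlgebra.nonneg_iff_eq_star_mul_self.1 hF.nonneg
  exact ⟨B, hB⟩

lemma trace_mul_hiddenState_mul_eq (B : Matrix ι ι ℂ) (z : {x // s x} → ℂ) :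
    (Bᴴ * B * hiddenState s z).trace.re * G z =
      1 / 2 * ∑ k, (‖∑ x : {x // s x}, B k x * z x‖ ^ 2 * G z) +
        (∑ x : {x // ¬ s x}, ((Bᴴ * B) x x).re) / (2 * Fintype.card {x // s x}) *
          (normSq z * G z) := by
  rw [trace_mul_hiddenState, ← Finset.sum_mul]
  ring

lemma trace_mul_hiddenState_mul_mem_sosCone (hF : F.PosSemidef) (hG : G ∈ sosCone _ d) :
    (fun z => (F * hiddenState s z).trace.re * G z) ∈ sosCone _ (d + 1) := by
  obtain ⟨B, rfl⟩ := exists_eq_conjTranspose_mul_self hF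
  simp_rw [trace_mul_hiddenState_mul_eq]
  refine (sosCone _ (d + 1)).add_mem (const_mul_mem_sosCone (by norm_num)
    (sum_mem_sosCone _ fun k _ => norm_linForm_sq_mul_mem_sosCone _ hG))
    (const_mul_mem_sosCone ?_ (normSq_mul_mem_sosCone hG))
  exact div_nonneg (Finset.sum_nonneg fun x _ => re_diag_conjTranspose_mul_self_nonneg B x)
    (by positivity)

/-- The rows of `B` restricted to the sector contribute half of the trace of `F` there. In the other
sector, the factor N gained from `normSq z` cancels the normalization 1/(2N) and leaves half of the
remaining trace. -/
lemma integral_trace_mul_hiddenState_mul_ge (hs : 0 < Fintype.card {x // s x})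
    (hF : F.PosSemidef) (hG : G ∈ sosCone _ d) :
    F.trace.re / 2 * ∫ z, G z ∂gaussianVector _ ≤
      ∫ z, (F * hiddenState s z).trace.re * G z ∂gaussianVector _ := by
  obtain ⟨B, rfl⟩ := exists_eq_conjTranspose_mul_self hF
  have hk : ∀ k, Integrable (fun z => ‖∑ x : {x // s x}, B k x * z x‖ ^ 2 * G z)
      (gaussianVector _) :=
    fun k => integrable_of_mem_sosCone (norm_linForm_sq_mul_mem_sosCone _ hG)
  simp_rw [trace_mul_hiddenState_mul_eq]
  rw [integral_add ((integrable_finsetSum _ fun k _ => hk k).const_mul _)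
      ((integrable_of_mem_sosCone (normSq_mul_mem_sosCone hG)).const_mul _),
    integral_const_mul, integral_const_mul, integral_finsetSum _ fun k _ => hk k,
    re_trace_conjTranspose_mul_self s]
  have h1 := Finset.sum_le_sum fun k (_ : k ∈ Finset.univ) =>
    integral_norm_linForm_sq_mul_ge (fun x : {x // s x} => B k x) hG
  rw [← Finset.sum_mul] at h1
  have hD : 0 ≤ ∑ x : {x // ¬ s x}, ((Bᴴ * B) x x).re :=
    Finset.sum_nonneg fun x _ => re_diag_conjTranspose_mul_self_nonneg B x
  have hN : (0 : ℝ) < Fintype.card {x // s x} := by exact_mod_cast hs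
  have h2 := mul_le_mul_of_nonneg_left (integral_normSq_mul_ge hG)
    (div_nonneg hD (by positivity : (0 : ℝ) ≤ 2 * Fintype.card {x // s x}))
  rw [← mul_assoc] at h2
  have h3 : (∑ x : {x // ¬ s x}, ((Bᴴ * B) x x).re) / (2 * (Fintype.card {x // s x} : ℝ)) *
      Fintype.card {x // s x} = (∑ x : {x // ¬ s x}, ((Bᴴ * B) x x).re) / 2 := by
    field_simp
  rw [h3] at h2
  linarith

/-! ### Conventional algorithms on unnormalized states -/

namespace ConventionalAlgorithm

/-- The homogeneous extension of `outputProb` to unnormalized states of trace `c`. -/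
noncomputable def homProb (M : Matrix ι ι ℂ) (c : ℝ) (S : Set ℝ) :
    {T : ℕ} → ConventionalAlgorithm ι T → ℝ
  -- Here `T` is the unused part of the budget; the padding gives all paths the same degree, even
  -- when they stop early.
  | T, .predict y => c ^ T * S.indicator (fun _ => 1) y
  | _, .measure F next => ∑ s, (F.effect s * M).trace.re * homProb M c S (next s)

lemma homProb_smul (ρ : Matrix ι ι ℂ) (c : ℝ) (S : Set ℝ) {T : ℕ}
    (A : ConventionalAlgorithm ι T) :
    A.homProb ((c : ℂ) • ρ) c S = c ^ T * A.outputProb ρ S := by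
  induction A with
  | predict y => rfl
  | measure F next ih =>
    simp only [homProb, outputProb, ih, POVM.outcomeProb, Finset.mul_sum, Matrix.mul_smul,
      Matrix.trace_smul, smul_eq_mul, Complex.re_ofReal_mul, pow_succ]
    exact Finset.sum_congr rfl fun s _ => by ring

end ConventionalAlgorithm

lemma re_trace_mul_nonneg {ρ : Matrix ι ι ℂ} (hF : F.PosSemidef) (hρ : ρ.PosSemidef) :
    0 ≤ (F * ρ).trace.re := by
  obtain ⟨B, rfl⟩ := exists_eq_conjTranspose_mul_self hF
  rw [Matrix.mul_assoc, Matrix.trace_mul_comm]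
  exact (Complex.le_def.1 (hρ.mul_mul_conjTranspose_same B).trace_nonneg).1

lemma POVM.sum_outcomeProb {k : ℕ} (P : POVM ι k) (ρ : Matrix ι ι ℂ) :
    ∑ t, P.outcomeProb ρ t = ρ.trace.re := by
  simp only [POVM.outcomeProb]
  rw [← Complex.re_sum, ← Matrix.trace_sum, ← Finset.sum_mul, P.sum_eq_one, Matrix.one_mul]

namespace ConventionalAlgorithm

variable {ρ : Matrix ι ι ℂ} {T : ℕ}

lemma outputProb_nonneg (hρ : ρ.PosSemidef) (S : Set ℝ) (A : ConventionalAlgorithm ι T) :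
    0 ≤ A.outputProb ρ S := by
  induction A with
  | predict y => exact Set.indicator_nonneg (fun _ _ => zero_le_one) y
  | measure F next ih =>
    exact Finset.sum_nonneg fun t _ => mul_nonneg (re_trace_mul_nonneg (F.posSemidef t) hρ) (ih t)

lemma outputProb_add_compl (hρ : ρ.trace = 1) (S : Set ℝ) (A : ConventionalAlgorithm ι T) :
    A.outputProb ρ S + A.outputProb ρ Sᶜ = 1 := by
  induction A with
  | predict y => by_cases h : y ∈ S <;> simp [outputProb, h]
  | measure F next ih =>
    simp only [outputProb]
    rw [← Finset.sum_add_distrib]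
    simp_rw [← mul_add, ih, mul_one]
    rw [POVM.sum_outcomeProb, hρ, Complex.one_re]

lemma outputProb_mono (hρ : ρ.PosSemidef) {S S' : Set ℝ} (h : S ⊆ S')
    (A : ConventionalAlgorithm ι T) : A.outputProb ρ S ≤ A.outputProb ρ S' := by
  induction A with
  | predict y => exact Set.indicator_le_indicator_of_subset h (fun _ => zero_le_one) y
  | measure F next ih =>
    exact Finset.sum_le_sum fun t _ =>
      mul_le_mul_of_nonneg_left (ih t) (re_trace_mul_nonneg (F.posSemidef t) hρ)

/-- The weight `G` collects the outcome probabilities on the path from the root, so the induction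
has to let it vary. -/
lemma homProb_mul_mem_sosCone (S : Set ℝ) (A : ConventionalAlgorithm ι T)
    (hG : G ∈ sosCone _ d) :
    (fun z => A.homProb (hiddenState s z) (normSq z) S * G z) ∈ sosCone _ (d + T) := by
  induction A generalizing d G with
  | predict y =>
    simp only [homProb]
    simp_rw [mul_comm (normSq _ ^ _), mul_assoc]
    exact const_mul_mem_sosCone (Set.indicator_nonneg (fun _ _ => zero_le_one) y)
      (normSq_pow_mul_mem_sosCone _ hG)
  | @measure T k F next ih =>
    simp only [homProb, Finset.sum_mul]
    refine sum_mem_sosCone _ fun t _ => ?_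
    have h := ih t (trace_mul_hiddenState_mul_mem_sosCone (F.posSemidef t) hG)
    rw [add_assoc, add_comm 1] at h
    convert h using 2
    ring

/-- The average of the outcome probabilities over the hidden vector is, up to a constant close to
one, at least the one of the maximally mixed state. -/
lemma integral_homProb_mul_ge (hs : 0 < Fintype.card {x // s x})
    (hcard : Fintype.card ι = 2 * Fintype.card {x // s x}) (S : Set ℝ)
    (A : ConventionalAlgorithm ι T) (hG : G ∈ sosCone _ d) :
    (Fintype.card {x // s x} : ℝ) ^ T *
        A.outputProb ((((Fintype.card ι : ℝ)⁻¹ : ℝ) : ℂ) • (1 : Matrix ι ι ℂ)) S *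
        ∫ z, G z ∂gaussianVector _ ≤
      ∫ z, A.homProb (hiddenState s z) (normSq z) S * G z ∂gaussianVector _ := by
  induction A generalizing d G with
  | predict y =>
    simp only [homProb, outputProb]
    simp_rw [mul_comm (normSq _ ^ _), mul_assoc]
    rw [integral_const_mul, mul_left_comm]
    exact mul_le_mul_of_nonneg_left (integral_normSq_pow_mul_ge _ hG)
      (Set.indicator_nonneg (fun _ _ => zero_le_one) y)
  | @measure T k F next ih =>
    -- The probability of the outcome `t` is absorbed into the weight, and the induction hypothesis
    -- is applied to the subtree with this new weight; adaptivity costs nothing.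
    have hG' := fun t => trace_mul_hiddenState_mul_mem_sosCone (s := s) (F.posSemidef t) hG
    have h1 : ∀ z, (ConventionalAlgorithm.measure F next).homProb (hiddenState s z) (normSq z) S *
        G z = ∑ t, (next t).homProb (hiddenState s z) (normSq z) S *
          ((F.effect t * hiddenState s z).trace.re * G z) := by
      intro z
      rw [homProb, Finset.sum_mul]
      exact Finset.sum_congr rfl fun t _ => by ring
    simp_rw [h1]
    rw [integral_finsetSum _ fun t _ =>
      integrable_of_mem_sosCone (homProb_mul_mem_sosCone S (next t) (hG' t))]
    rw [outputProb, Finset.mul_sum, Finset.sum_mul]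
    refine Finset.sum_le_sum fun t _ => le_trans ?_ (ih t (hG' t))
    have hmm : ((((Fintype.card ι : ℝ)⁻¹ : ℝ) : ℂ) • (1 : Matrix ι ι ℂ)).PosSemidef :=
      Matrix.PosSemidef.one.smul (by
        rw [Complex.zero_le_real]; positivity)
    have hP := outputProb_nonneg hmm S (next t)
    have hN : (0 : ℝ) < Fintype.card {x // s x} := by exact_mod_cast hs
    have h2 := integral_trace_mul_hiddenState_mul_ge hs (F.posSemidef t) hG
    have h3 : F.outcomeProb ((((Fintype.card ι : ℝ)⁻¹ : ℝ) : ℂ) • (1 : Matrix ι ι ℂ)) t *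
        Fintype.card {x // s x} = (F.effect t).trace.re / 2 := by
      rw [POVM.outcomeProb, Matrix.mul_smul, Matrix.mul_one, Matrix.trace_smul, smul_eq_mul,
        Complex.re_ofReal_mul, hcard]
      push_cast
      field_simp
    rw [← h3] at h2
    refine le_trans (le_of_eq ?_) (mul_le_mul_of_nonneg_left h2 (mul_nonneg (pow_nonneg hN.le T) hP))
    rw [pow_succ]; ring

end ConventionalAlgorithm

end Hidden

end QPCA

namespace QPCA

open MeasureTheory
open scoped ComplexConjugate Nat

section

variable {κ : Type} [Fintype κ]

/-! ### Hidden states as instances of the task -/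

lemma normSq_smul (c : ℝ) (z : κ → ℂ) : normSq ((c : ℂ) • z) = c ^ 2 * normSq z := by
  simp [normSq, Finset.mul_sum, mul_pow]

end

section Hidden

variable {ι : Type} [Fintype ι] [DecidableEq ι] {s : ι → Prop} [DecidablePred s]

lemma hiddenState_smul (c : ℝ) (z : {x // s x} → ℂ) :
    hiddenState s ((c : ℂ) • z) = ((c ^ 2 : ℝ) : ℂ) • hiddenState s z := by
  have h : extendVec s ((c : ℂ) • z) = (c : ℂ) • extendVec s z := by
    ext x; by_cases hx : s x <;> simp [extendVec, hx]
  rw [hiddenState, hiddenState, h, normSq_smul, star_smul, Matrix.smul_vecMulVec,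
    Matrix.vecMulVec_smul, smul_add, smul_smul, smul_smul, smul_smul, smul_smul, RCLike.star_def,
    Complex.conj_ofReal]
  congr 2
  · push_cast; ring
  · push_cast; ring

omit [DecidableEq ι] in
lemma star_extendVec_dotProduct_self (z : {x // s x} → ℂ) :
    star (extendVec s z) ⬝ᵥ extendVec s z = (normSq z : ℂ) := by
  rw [dotProduct, sum_mul_extendVec, normSq, Complex.ofReal_sum]
  refine Finset.sum_congr rfl fun x _ => ?_
  rw [Pi.star_apply, extendVec, dif_pos x.2, mul_comm, RCLike.star_def, Complex.mul_conj,
    Complex.normSq_eq_norm_sq]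

lemma hiddenState_mulVec (z : {x // s x} → ℂ) (v : ι → ℂ) (x : ι) :
    (hiddenState s z *ᵥ v) x = 1 / 2 * (star (extendVec s z) ⬝ᵥ v) * extendVec s z x +
      ((normSq z / (2 * Fintype.card {x // s x}) : ℝ) : ℂ) * if s x then 0 else v x := by
  rw [hiddenState, Matrix.add_mulVec, Matrix.smul_mulVec, Matrix.smul_mulVec,
    Matrix.vecMulVec_mulVec]
  simp only [Pi.add_apply, Pi.smul_apply, smul_eq_mul, Matrix.mulVec_diagonal]
  congr 1
  · simp; ring
  · split_ifs <;> simp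

lemma hiddenState_posSemidef (z : {x // s x} → ℂ) : (hiddenState s z).PosSemidef := by
  refine ((Matrix.posSemidef_vecMulVec_self_star _).smul ?_).add
    (Matrix.PosSemidef.smul (Matrix.PosSemidef.diagonal fun x => ?_) ?_)
  · rw [show (1 / 2 : ℂ) = ((1 / 2 : ℝ) : ℂ) by norm_num, Complex.zero_le_real]; norm_num
  · show (0 : ℂ) ≤ if s x then 0 else 1
    split_ifs <;> simp
  · rw [Complex.zero_le_real]
    exact div_nonneg (normSq_nonneg z) (by positivity)

lemma hiddenState_isDensityMatrix (hs : 0 < Fintype.card {x // s x})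
    (hcard : Fintype.card ι = 2 * Fintype.card {x // s x}) {z : {x // s x} → ℂ}
    (hz : normSq z = 1) : IsDensityMatrix (hiddenState s z) := by
  refine ⟨hiddenState_posSemidef z, ?_⟩
  have hN : (Fintype.card {x // s x} : ℂ) ≠ 0 := by exact_mod_cast hs.ne'
  have h2 : ∑ x : ι, (if s x then (0 : ℂ) else 1) = Fintype.card {x // s x} := by
    have h : Fintype.card {x // ¬ s x} = Fintype.card {x // s x} := by
      rw [Fintype.card_subtype_compl]; omega
    have h0 : ∀ x : {x // s x}, (if s x then (0 : ℂ) else 1) = 0 := fun x => if_pos x.2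
    have h1 : ∀ x : {x // ¬ s x}, (if s x then (0 : ℂ) else 1) = 1 := fun x => if_neg x.2
    rw [← h, ← Fintype.sum_subtype_add_sum_subtype s]
    simp [h0, h1]
  rw [hiddenState, Matrix.trace_add, Matrix.trace_smul, Matrix.trace_smul, Matrix.trace_vecMulVec,
    dotProduct_comm, star_extendVec_dotProduct_self, Matrix.trace_diagonal, h2, hz]
  push_cast
  simp only [smul_eq_mul]
  field_simp
  norm_num

lemma hiddenState_isPrincipalComponent {δ : ℝ} (hδ : δ ≤ 1 / 2 - (Fintype.card ι : ℝ)⁻¹)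
    (hcard : Fintype.card ι = 2 * Fintype.card {x // s x}) {z : {x // s x} → ℂ}
    (hz : normSq z = 1) : IsPrincipalComponent δ (hiddenState s z) (extendVec s z) := by
  refine ⟨by rw [star_extendVec_dotProduct_self, hz, Complex.ofReal_one], 1 / 2, ?_, ?_⟩
  · ext x
    rw [hiddenState_mulVec, star_extendVec_dotProduct_self, hz]
    by_cases hx : s x <;> simp [hx, extendVec]
  · intro μ v hv hφ h
    -- Reading the eigenvalue equation at a coordinate where `v` does not vanish forces μ to be 0
    -- inside the sector and 1/dim outside.
    obtain ⟨x, hx⟩ := Function.ne_iff.1 hv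
    have hx' := congrFun h x
    rw [hiddenState_mulVec, hφ, hz, mul_zero, zero_mul, zero_add, Pi.smul_apply,
      smul_eq_mul] at hx'
    have hc : (1 : ℝ) / (2 * (Fintype.card {x // s x} : ℝ)) = (Fintype.card ι : ℝ)⁻¹ := by
      rw [hcard]; push_cast; rw [one_div]
    have hpos : 0 ≤ (Fintype.card ι : ℝ)⁻¹ := by positivity
    rw [hc] at hx'
    by_cases hsx : s x
    · rw [if_pos hsx, mul_zero, zero_eq_mul] at hx'
      have : μ = 0 := by exact_mod_cast hx'.resolve_right hx
      linarith
    · rw [if_neg hsx] at hx'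
      have : (Fintype.card ι : ℝ)⁻¹ = μ := by exact_mod_cast mul_right_cancel₀ hx hx'
      linarith

/-- If an algorithm outputs a value outside `S` with probability at most `1/5` on all the hidden
states, then it hardly ever does so on the maximally mixed state. -/
lemma pow_mul_outputProb_le (hs : 0 < Fintype.card {x // s x})
    (hcard : Fintype.card ι = 2 * Fintype.card {x // s x}) {T : ℕ} (S : Set ℝ)
    (A : ConventionalAlgorithm ι T)
    (h : ∀ z : {x // s x} → ℂ, normSq z = 1 → A.outputProb (hiddenState s z) S ≤ 1 / 5) :
    (Fintype.card {x // s x} : ℝ) ^ (T + 1) *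
        A.outputProb ((((Fintype.card ι : ℝ)⁻¹ : ℝ) : ℂ) • (1 : Matrix ι ι ℂ)) S ≤
      1 / 5 * ∏ i ∈ Finset.range (T + 1), ((Fintype.card {x // s x} : ℝ) + i) := by
  -- The extra factor `normSq z ^ 1` makes the inequality hold at z = 0, which cannot be normalized,
  -- even if T = 0.
  have hpt : ∀ z : {x // s x} → ℂ, A.homProb (hiddenState s z) (normSq z) S * normSq z ^ 1 ≤
      1 / 5 * normSq z ^ (T + 1) := by
    intro z
    rcases (normSq_nonneg z).eq_or_lt with h0 | h0
    · simp [← h0]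
    · have hu : normSq (((√(normSq z))⁻¹ : ℝ) • z : {x // s x} → ℂ) = 1 := by
        have := normSq_smul (√(normSq z))⁻¹ z
        rw [inv_pow, Real.sq_sqrt h0.le, inv_mul_cancel₀ h0.ne'] at this
        rw [← this]; rfl
      set u : {x // s x} → ℂ := ((√(normSq z))⁻¹ : ℝ) • z with hudef
      have hz : z = ((√(normSq z) : ℝ) : ℂ) • u := by
        have h1 : (√(normSq z) : ℝ) ≠ 0 := (Real.sqrt_pos.2 h0).ne'
        rw [hudef, Complex.coe_smul, smul_smul, mul_inv_cancel₀ h1, one_smul]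
      have hst : hiddenState s z = ((normSq z : ℝ) : ℂ) • hiddenState s u := by
        conv_lhs => rw [hz, hiddenState_smul, Real.sq_sqrt h0.le]
      rw [hst, ConventionalAlgorithm.homProb_smul, pow_one, pow_succ]
      have h2 : 0 ≤ normSq z ^ T * normSq z := by positivity
      nlinarith [mul_le_mul_of_nonneg_left (h u hu) h2]
  have h1 := ConventionalAlgorithm.integral_homProb_mul_ge hs hcard S A
    (normSq_pow_mem_sosCone (κ := {x // s x}) 1)
  have h2 := integral_mono
    (integrable_of_mem_sosCone (ConventionalAlgorithm.homProb_mul_mem_sosCone S A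
      (normSq_pow_mem_sosCone (κ := {x // s x}) 1)))
    ((integrable_of_mem_sosCone (normSq_pow_mem_sosCone (κ := {x // s x}) (T + 1))).const_mul
      (1 / 5)) hpt
  rw [integral_const_mul, integral_normSq_pow] at h2
  rw [integral_normSq_pow] at h1
  refine le_trans (le_of_eq ?_) (h1.trans h2)
  simp only [Finset.prod_range_one, Nat.cast_zero, add_zero]
  ring

end Hidden

variable {n : ℕ}

/-! ### The conventional lower bound on qubits -/

lemma pauliZ_expectation_extendVec (j : Fin n) (b : Fin 2)
    {z : {x : Qubits n // x j = b} → ℂ} (hz : normSq z = 1) :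
    expectation (pauliZ j) (extendVec (fun x : Qubits n => x j = b) z) =
      if b = 0 then 1 else -1 := by
  have h : pauliZ j *ᵥ (extendVec (fun x : Qubits n => x j = b) z) =
      (if b = 0 then 1 else -1 : ℂ) • extendVec (fun x : Qubits n => x j = b) z := by
    ext x
    rw [pauliZ, Matrix.mulVec_diagonal, Pi.smul_apply, smul_eq_mul]
    by_cases hx : x j = b
    · rw [hx]
    · simp [extendVec, hx]
  rw [expectation, h, dotProduct_smul, star_extendVec_dotProduct_self, hz]
  split_ifs <;> simp

lemma card_qubits (n : ℕ) : Fintype.card (Qubits n) = 2 ^ n := by simp [Qubits]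

lemma card_qubits_sector (j : Fin n) (b : Fin 2) :
    Fintype.card (Qubits n) = 2 * Fintype.card {x : Qubits n // x j = b} := by
  have hflip : ∀ b : Fin 2, Fintype.card {x : Qubits n // x j = b} =
      Fintype.card {x : Qubits n // x j = b + 1} := by
    intro b
    refine Fintype.card_congr
      -- Adding 1 flips every bit, which exchanges the two sectors.
      ⟨fun x => ⟨x.1 + 1, by simp [x.2]⟩, fun x => ⟨x.1 + 1, ?_⟩, fun x => ?_, fun x => ?_⟩
    · have := x.2
      simp only [Pi.add_apply, Pi.one_apply, this]
      exact (by decide : ∀ b : Fin 2, b + 1 + 1 = b) b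
    · ext i; simp; omega
    · ext i; simp; omega
  have h2 : Fintype.card {x : Qubits n // ¬ x j = b} =
      Fintype.card {x : Qubits n // x j = b + 1} := by
    refine Fintype.card_congr (Equiv.subtypeEquivRight fun x => ?_)
    have : ∀ a b : Fin 2, ¬ a = b ↔ a = b + 1 := by decide
    exact this _ _
  have h3 := Fintype.card_subtype_compl (fun x : Qubits n => x j = b)
  have h4 := Fintype.card_subtype_le (fun x : Qubits n => x j = b)
  rw [h2, ← hflip b] at h3
  omega

/-- A conventional algorithm that solves the task needs a number of copies of the order of the
square root of the dimension. -/
lemma card_le_copies_sq (j : Fin n) {δ : ℝ} (hδ : δ ≤ 1 / 2 - ((2 : ℝ) ^ n)⁻¹) {T : ℕ}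
    (A : ConventionalAlgorithm (Qubits n) T)
    (h : PredictsPrincipalComponent (pauliZ j) δ fun ρ S => A.outputProb ρ S) :
    (2 : ℝ) ^ n ≤ 4 * (T : ℝ) ^ 2 := by
  obtain ⟨N, hN⟩ : ∃ N, Fintype.card (Qubits n) = 2 * N := ⟨_, card_qubits_sector j 0⟩
  have hNb : ∀ b, Fintype.card {x : Qubits n // x j = b} = N := fun b => by
    have := card_qubits_sector j b; omega
  have hNpos : 0 < N := by
    have : 0 < Fintype.card (Qubits n) := by rw [card_qubits]; positivity
    omega
  have hcard : (Fintype.card (Qubits n) : ℝ) = 2 ^ n := by rw [card_qubits]; push_cast; rfl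
  set P : ℝ := ∏ i ∈ Finset.range (T + 1), ((N : ℝ) + i)
  set ρ₀ : Matrix (Qubits n) (Qubits n) ℂ :=
    (((Fintype.card (Qubits n) : ℝ)⁻¹ : ℝ) : ℂ) • (1 : Matrix (Qubits n) (Qubits n) ℂ) with hρ₀
  have key : ∀ b : Fin 2, (N : ℝ) ^ (T + 1) *
      A.outputProb ρ₀ {y : ℝ | |y - if b = 0 then 1 else -1| ≤ 0.25}ᶜ ≤ 1 / 5 * P := by
    intro b
    have hpos : 0 < Fintype.card {x : Qubits n // x j = b} := by rw [hNb]; exact hNpos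
    have := pow_mul_outputProb_le (s := fun x : Qubits n => x j = b) hpos
      (card_qubits_sector j b) {y : ℝ | |y - if b = 0 then 1 else -1| ≤ 0.25}ᶜ A ?_
    · rwa [hNb] at this
    · intro z hz
      have h1 := hiddenState_isDensityMatrix hpos (card_qubits_sector j b) hz
      have h2 := h _ _ h1 (hiddenState_isPrincipalComponent (by rw [hcard]; exact hδ)
        (card_qubits_sector j b) hz)
      rw [pauliZ_expectation_extendVec j b hz] at h2
      have h3 := A.outputProb_add_compl h1.trace_eq_one
        {y : ℝ | |y - if b = 0 then 1 else -1| ≤ 0.25}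
      norm_num at h2 ⊢
      norm_num at h3
      linarith
  have hpsd : ρ₀.PosSemidef := Matrix.PosSemidef.one.smul (by
    rw [Complex.zero_le_real]; positivity)
  have htr : ρ₀.trace = 1 := by
    have : (Fintype.card (Qubits n) : ℂ) ≠ 0 := by
      rw [card_qubits]; positivity
    rw [hρ₀, Matrix.trace_smul, Matrix.trace_one, smul_eq_mul]
    push_cast
    rw [inv_mul_cancel₀ this]
  have h0 := key 0
  have h1 := key 1
  set S₀ : Set ℝ := {y : ℝ | |y - if (0 : Fin 2) = 0 then 1 else -1| ≤ 0.25}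
  set S₁ : Set ℝ := {y : ℝ | |y - if (1 : Fin 2) = 0 then 1 else -1| ≤ 0.25}
  -- The accepted intervals around 1 and -1 are disjoint, so every answer is wrong for at least one
  -- sector.
  have hsub : S₀ ⊆ S₁ᶜ := by
    intro y hy hy'
    simp only [S₀, S₁, Set.mem_ofPred_eq, if_true, one_ne_zero, if_false, abs_le] at hy hy'
    norm_num at hy hy'
    linarith [hy.1, hy'.2]
  have hsum : 1 ≤ A.outputProb ρ₀ S₀ᶜ + A.outputProb ρ₀ S₁ᶜ := by
    have := A.outputProb_add_compl htr S₀
    have := A.outputProb_mono hpsd hsub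
    linarith
  have hNR : (0 : ℝ) < N := by exact_mod_cast hNpos
  have hNT : (0 : ℝ) < (N : ℝ) ^ (T + 1) := by positivity
  have hNP : (N : ℝ) ^ (T + 1) ≤ 2 / 5 * P := by
    nlinarith [mul_le_mul_of_nonneg_left hsum hNT.le]
  have hP : 0 < P := by linarith
  have hB := prod_range_add_mul_le hNR.le (T + 1)
  have hB' : P * (2 * N - (T + 1) * T) ≤ P * (4 / 5 * N) := by
    have : P * (2 * N - ((T + 1 : ℕ) : ℝ) * (((T + 1 : ℕ) : ℝ) - 1)) ≤ 2 * N * N ^ (T + 1) := hB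
    push_cast at this
    rw [add_sub_cancel_right] at this
    nlinarith
  have hT := le_of_mul_le_mul_left hB' hP
  have h2N : (2 : ℝ) ^ n = 2 * N := by rw [← hcard, hN]; push_cast; rfl
  -- Now T(T+1) ≥ 6N/5. With T ≥ 1 the left side is at most 2T², whence 2N ≤ 4T².
  have hTpos : 1 ≤ T := by
    by_contra hlt
    have : T = 0 := by omega
    subst this
    norm_num at hT
    linarith
  have hT1 : (1 : ℝ) ≤ T := by exact_mod_cast hTpos
  rw [h2N]
  nlinarith

theorem conventional_lower_bound :
    ∃ c : ℝ, 0 < c ∧ ∀ δ : ℝ, 0 < δ → δ < 1 / 2 → ∃ n₀ : ℕ, ∀ (n : ℕ) (j : Fin n), n₀ ≤ n →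
      ∀ (T : ℕ) (A : ConventionalAlgorithm (Qubits n) T),
        PredictsPrincipalComponent (pauliZ j) δ (fun ρ S => A.outputProb ρ S) →
        c * (2 : ℝ) ^ ((n : ℝ) / 2) ≤ (T : ℝ) := by
  refine ⟨1 / 2, by norm_num, fun δ _ hδ => ?_⟩
  obtain ⟨n₀, hn₀⟩ := exists_pow_lt_of_lt_one (show 0 < 1 / 2 - δ by linarith)
    (show (1 / 2 : ℝ) < 1 by norm_num)
  refine ⟨n₀, fun n j hle T A h => ?_⟩
  have h1 : ((2 : ℝ) ^ n)⁻¹ ≤ 1 / 2 - δ := by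
    rw [← inv_pow, ← one_div]
    exact (pow_le_pow_of_le_one (by norm_num) (by norm_num) hle).trans hn₀.le
  have h2 := card_le_copies_sq j (by linarith) A h
  have h3 : ((2 : ℝ) ^ ((n : ℝ) / 2)) ^ 2 = 2 ^ n := by
    rw [← Real.rpow_natCast, ← Real.rpow_mul (by norm_num)]
    norm_num
  rw [← h3] at h2
  have h4 : (2 : ℝ) ^ ((n : ℝ) / 2) ≤ 2 * T :=
    le_of_sq_le_sq (by nlinarith) (by positivity)
  linarith

end QPCA

namespace QPCA

/-! ### Tensor products and joint measurements on blocks -/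

section Tensor

variable {X : Type} [Fintype X] [DecidableEq X] {m : ℕ}

/-- The tensor product of matrices. -/
def tensor (M : Fin m → Matrix X X ℂ) : Matrix (Fin m → X) (Fin m → X) ℂ :=
  Matrix.of fun x y => ∏ j, M j (x j) (y j)

omit [DecidableEq X] in
lemma tensor_mul (M M' : Fin m → Matrix X X ℂ) :
    tensor M * tensor M' = tensor fun j => M j * M' j := by
  ext x y
  simp only [tensor, Matrix.mul_apply, Matrix.of_apply, Finset.prod_univ_sum,
    Fintype.piFinset_univ, Finset.prod_mul_distrib]

omit [DecidableEq X] in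
lemma trace_tensor (M : Fin m → Matrix X X ℂ) : (tensor M).trace = ∏ j, (M j).trace := by
  simp only [tensor, Matrix.trace, Matrix.diag_apply, Matrix.of_apply, Finset.prod_univ_sum,
    Fintype.piFinset_univ]

omit [Fintype X] [DecidableEq X] in
lemma conjTranspose_tensor (M : Fin m → Matrix X X ℂ) : (tensor M)ᴴ = tensor fun j => (M j)ᴴ := by
  ext x y
  simp [tensor, Matrix.conjTranspose_apply]

omit [Fintype X] in
lemma tensor_one : tensor (fun _ : Fin m => (1 : Matrix X X ℂ)) = 1 := by
  ext x y
  simp only [tensor, Matrix.of_apply, Matrix.one_apply]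
  rw [Finset.prod_ite_zero, Finset.prod_const_one]
  simp [funext_iff]

omit [Fintype X] [DecidableEq X] in
lemma sum_tensor {Ω : Type} [Fintype Ω] (E : Ω → Matrix X X ℂ) :
    ∑ s : Fin m → Ω, tensor (fun j => E (s j)) = tensor fun _ => ∑ ω, E ω := by
  ext x y
  simp only [tensor, Matrix.sum_apply, Matrix.of_apply, Finset.prod_univ_sum,
    Fintype.piFinset_univ]

lemma tensor_posSemidef {M : Fin m → Matrix X X ℂ} (h : ∀ j, (M j).PosSemidef) :
    (tensor M).PosSemidef := by
  choose B hB using fun j => exists_eq_conjTranspose_mul_self (h j)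
  have : tensor M = (tensor B)ᴴ * tensor B := by
    rw [conjTranspose_tensor, tensor_mul]
    congr 1; ext1 j; exact hB j
  rw [this]
  exact Matrix.posSemidef_conjTranspose_mul_self _

/-- The real part of a product of traces is the product of the real parts only because each trace is
real. -/
lemma trace_mul_eq_ofReal_re {F R : Matrix X X ℂ} (hF : F.PosSemidef) (hR : R.PosSemidef) :
    (F * R).trace = ((F * R).trace.re : ℂ) := by
  obtain ⟨B, rfl⟩ := exists_eq_conjTranspose_mul_self hF
  rw [Matrix.mul_assoc, Matrix.trace_mul_comm]
  exact (Complex.ext rfl (Complex.le_def.1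
    (hR.mul_mul_conjTranspose_same B).trace_nonneg).2.symm)

lemma copies_posSemidef {R : Matrix X X ℂ} (hR : R.PosSemidef) : (copies m R).PosSemidef :=
  tensor_posSemidef fun _ => hR

omit [DecidableEq X] in
lemma trace_copies (R : Matrix X X ℂ) : (copies m R).trace = R.trace ^ m := by
  have h : (copies m R).trace = ∏ _j : Fin m, R.trace := trace_tensor fun _ => R
  rw [h, Finset.prod_const, Finset.card_univ, Fintype.card_fin]

end Tensor

variable {ι : Type} [Fintype ι] [DecidableEq ι] {k : ℕ}

/-- Splitting `m * k` copies into `m` blocks of `k` copies. -/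
def blocks (ι : Type) (m k : ℕ) : (Fin (m * k) → ι) ≃ (Fin m → Fin k → ι) :=
  (Equiv.arrowCongr finProdFinEquiv.symm (Equiv.refl ι)).trans (Equiv.curry _ _ _)

omit [Fintype ι] [DecidableEq ι] in
lemma copies_mul (m k : ℕ) (ρ : Matrix ι ι ℂ) :
    copies (m * k) ρ = (copies m (copies k ρ)).submatrix (blocks ι m k) (blocks ι m k) := by
  ext x y
  simp only [copies, Matrix.of_apply, Matrix.submatrix_apply, blocks]
  rw [← Fintype.prod_prod_type', ← finProdFinEquiv.prod_comp]
  rfl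

/-- Measuring each of `m` blocks of `k` copies in the same way, and computing the output from all
the outcomes. -/
lemma exists_quantumEnhancedAlgorithm {Ω : Type} [Fintype Ω]
    {E : Ω → Matrix (Fin k → ι) (Fin k → ι) ℂ} (hE : ∀ ω, (E ω).PosSemidef)
    (hsum : ∑ ω, E ω = 1) (m : ℕ) (f : (Fin m → Ω) → ℝ) :
    ∃ A : QuantumEnhancedAlgorithm ι (m * k), ∀ ρ : Matrix ι ι ℂ, ρ.PosSemidef → ∀ S,
      A.outputProb ρ S = ∑ s : Fin m → Ω, (∏ j, (E (s j) * copies k ρ).trace.re) *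
        S.indicator (fun _ => 1) (f s) := by
  classical
  let e := Fintype.equivFin (Fin m → Ω)
  let b := blocks ι m k
  refine ⟨⟨Fintype.card (Fin m → Ω), ⟨fun t =>
    (tensor fun j => E (e.symm t j)).submatrix b b, fun t =>
    (tensor_posSemidef fun j => hE _).submatrix b, ?_⟩, fun t => f (e.symm t)⟩, ?_⟩
  · rw [e.symm.sum_comp fun s => (tensor fun j => E (s j)).submatrix b b]
    have h : ∑ s : Fin m → Ω, (tensor fun j => E (s j)).submatrix b b =
        (∑ s : Fin m → Ω, tensor fun j => E (s j)).submatrix b b := by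
      ext x y; simp [Matrix.sum_apply]
    rw [h, sum_tensor, hsum, tensor_one, Matrix.submatrix_one_equiv]
  · intro ρ hρ S
    rw [QuantumEnhancedAlgorithm.outputProb]
    refine Fintype.sum_equiv e.symm _ _ fun t => ?_
    congr 1
    simp only [POVM.outcomeProb]
    rw [copies_mul, Matrix.submatrix_mul_equiv]
    have h1 : ∀ M : Matrix (Fin m → Fin k → ι) (Fin m → Fin k → ι) ℂ,
        (M.submatrix b b).trace = M.trace := fun M => b.sum_comp fun x => M x x
    have h2 : copies m (copies k ρ) = tensor fun _ => copies k ρ := rfl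
    rw [h1, h2, tensor_mul, trace_tensor,
      Finset.prod_congr rfl fun j _ => trace_mul_eq_ofReal_re (hE _) (copies_posSemidef hρ),
      ← Complex.ofReal_prod, Complex.ofReal_re]

/-! ### Empirical means of independent outcomes -/

section Sampling

variable {Ω : Type} [Fintype Ω] {p : Ω → ℝ}

lemma sum_prod_eq_one (hp : ∑ ω, p ω = 1) (m : ℕ) : ∑ s : Fin m → Ω, ∏ j, p (s j) = 1 := by
  have := Finset.prod_univ_sum (fun _ : Fin m => (Finset.univ : Finset Ω)) fun _ ω => p ω
  rw [Fintype.piFinset_univ] at this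
  rw [← this, hp, Finset.prod_const_one]

lemma sum_fin_succ_arrow (m : ℕ) (F : (Fin (m + 1) → Ω) → ℝ) :
    ∑ s, F s = ∑ ω, ∑ s : Fin m → Ω, F (Fin.cons ω s) := by
  rw [← (Fin.consEquiv fun _ : Fin (m + 1) => Ω).sum_comp, Fintype.sum_prod_type]
  rfl

/-- Additivity of the variance: cross terms vanish because `h` is centred. -/
lemma sum_prod_mul_sum_sq (hp : ∑ ω, p ω = 1) {h : Ω → ℝ} (hh : ∑ ω, p ω * h ω = 0) (m : ℕ) :
    ∑ s : Fin m → Ω, (∏ j, p (s j)) * (∑ j, h (s j)) ^ 2 = m * ∑ ω, p ω * h ω ^ 2 := by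
  induction m with
  | zero => simp
  | succ m ih =>
    rw [sum_fin_succ_arrow]
    simp only [Fin.prod_univ_succ, Fin.sum_univ_succ, Fin.cons_zero, Fin.cons_succ]
    have h1 : ∀ ω, ∑ s : Fin m → Ω, (p ω * ∏ j, p (s j)) * (h ω + ∑ j, h (s j)) ^ 2 =
        p ω * h ω ^ 2 + 2 * (∑ s : Fin m → Ω, (∏ j, p (s j)) * ∑ j, h (s j)) * (p ω * h ω) +
          p ω * (m * ∑ ω, p ω * h ω ^ 2) := by
      intro ω
      rw [← ih, ← mul_one (p ω * h ω ^ 2), ← sum_prod_eq_one hp m]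
      simp only [Finset.mul_sum, Finset.sum_mul, ← Finset.sum_add_distrib]
      refine Finset.sum_congr rfl fun s _ => ?_
      simp only [← Finset.mul_sum, ← Finset.sum_mul]
      ring
    simp_rw [h1]
    rw [Finset.sum_add_distrib, Finset.sum_add_distrib, ← Finset.mul_sum, ← Finset.sum_mul, hh, hp]
    push_cast; ring

/-- Chebyshev's inequality for the empirical mean. -/
lemma sum_prod_mul_indicator_le (hp0 : ∀ ω, 0 ≤ p ω) (hp : ∑ ω, p ω = 1) (f : Ω → ℝ) {v : ℝ}
    (hv : ∑ ω, p ω * f ω ^ 2 ≤ v) {m : ℕ} (hm : 0 < m) {ε : ℝ} (hε : 0 < ε) :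
    ∑ s : Fin m → Ω, (∏ j, p (s j)) *
      {t : ℝ | ε < |t - ∑ ω, p ω * f ω|}.indicator (fun _ => 1) ((∑ j, f (s j)) / m) ≤
      v / (m * ε ^ 2) := by
  set μ := ∑ ω, p ω * f ω with hμ
  have hmR : (0 : ℝ) < m := by exact_mod_cast hm
  have hh : ∑ ω, p ω * (f ω - μ) = 0 := by
    simp_rw [mul_sub]
    rw [Finset.sum_sub_distrib, ← Finset.sum_mul, hp, one_mul, ← hμ, sub_self]
  have hvar : ∑ ω, p ω * (f ω - μ) ^ 2 ≤ v := by
    have : ∑ ω, p ω * (f ω - μ) ^ 2 = ∑ ω, p ω * f ω ^ 2 - μ ^ 2 := by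
      have h1 : ∀ ω, p ω * (f ω - μ) ^ 2 = p ω * f ω ^ 2 - 2 * μ * (p ω * f ω) + p ω * μ ^ 2 :=
        fun ω => by ring
      simp_rw [h1]
      rw [Finset.sum_add_distrib, Finset.sum_sub_distrib, ← Finset.mul_sum, ← Finset.sum_mul, hp,
        ← hμ]
      ring
    rw [this]
    nlinarith [sq_nonneg μ]
  have hpt : ∀ s : Fin m → Ω, (∏ j, p (s j)) *
      {t : ℝ | ε < |t - μ|}.indicator (fun _ => 1) ((∑ j, f (s j)) / m) ≤
      ((m : ℝ) * ε)⁻¹ ^ 2 * ((∏ j, p (s j)) * (∑ j, (f (s j) - μ)) ^ 2) := by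
    intro s
    have hP : 0 ≤ ∏ j, p (s j) := Finset.prod_nonneg fun j _ => hp0 _
    rw [mul_left_comm]
    refine mul_le_mul_of_nonneg_left ?_ hP
    by_cases ht : (∑ j, f (s j)) / m ∈ {t : ℝ | ε < |t - μ|}
    swap
    · rw [Set.indicator_of_notMem ht]; positivity
    rw [Set.indicator_of_mem ht]
    have hs : ∑ j, (f (s j) - μ) = m * ((∑ j, f (s j)) / m - μ) := by
      rw [Finset.sum_sub_distrib]
      simp
      field_simp
    rw [hs, ← mul_pow, ← sq_abs, abs_mul, abs_mul, abs_of_pos hmR, abs_of_pos (by positivity)]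
    have ht' : ε < |(∑ j, f (s j)) / m - μ| := ht
    refine one_le_pow₀ ?_
    rw [inv_mul_eq_div, one_le_div (by positivity)]
    exact mul_le_mul_of_nonneg_left ht'.le hmR.le
  refine (Finset.sum_le_sum fun s _ => hpt s).trans ?_
  rw [← Finset.mul_sum, sum_prod_mul_sum_sq hp hh]
  have : ((m : ℝ) * ε)⁻¹ ^ 2 * (m * ∑ ω, p ω * (f ω - μ) ^ 2) =
      (∑ ω, p ω * (f ω - μ) ^ 2) / (m * ε ^ 2) := by
    field_simp
  rw [this]
  gcongr

end Sampling

end QPCA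

namespace QPCA

variable {ι : Type} [Fintype ι] [DecidableEq ι]

/-! ### Cyclic shifts and powers of a state -/

/-- Closed sums over walks are entries of powers. -/
lemma sum_walk (M : Matrix ι ι ℂ) (K : ℕ) (g : ι → ι → ℂ) :
    ∑ y : Fin (K + 1) → ι, g (y 0) (y (Fin.last K)) * ∏ t : Fin K, M (y t.castSucc) (y t.succ) =
      ∑ a, ∑ b, g a b * (M ^ K) a b := by
  induction K generalizing g with
  | zero =>
    rw [← (Equiv.funUnique (Fin 1) ι).symm.sum_comp]
    refine Finset.sum_congr rfl fun a _ => ?_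
    simp [Matrix.one_apply]
  | succ K ih =>
    rw [← (Fin.consEquiv fun _ : Fin (K + 2) => ι).sum_comp, Fintype.sum_prod_type]
    refine Finset.sum_congr rfl fun a _ => ?_
    have h := ih fun c b => g a b * M a c
    calc _ = ∑ y : Fin (K + 1) → ι, g a (y (Fin.last K)) * M a (y 0) *
          ∏ t : Fin K, M (y t.castSucc) (y t.succ) := by
          refine Finset.sum_congr rfl fun y _ => ?_
          rw [Fin.prod_univ_succ, mul_assoc]
          rfl
      _ = _ := by
          rw [h, Finset.sum_comm]
          refine Finset.sum_congr rfl fun b _ => ?_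
          rw [pow_succ', Matrix.mul_apply, Finset.mul_sum]
          exact Finset.sum_congr rfl fun c _ => by ring

/-- The cyclic shift of `K + 1` copies composed with a diagonal operator on the first one. -/
def shiftDiag (K : ℕ) (z : ι → ℂ) : Matrix (Fin (K + 1) → ι) (Fin (K + 1) → ι) ℂ :=
  Matrix.of fun x y => if x = (fun t => y (t + 1)) then z (y 0) else 0

lemma trace_shiftDiag_mul_copies (K : ℕ) (z : ι → ℂ) (ρ : Matrix ι ι ℂ) :
    (shiftDiag K z * copies (K + 1) ρ).trace = (Matrix.diagonal z * ρ ^ (K + 1)).trace := by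
  have h1 : (shiftDiag K z * copies (K + 1) ρ).trace =
      ∑ y : Fin (K + 1) → ι, (z (y 0) * ρ (y (Fin.last K)) (y 0)) *
        ∏ t : Fin K, ρ (y t.castSucc) (y t.succ) := by
    simp only [Matrix.trace, Matrix.diag_apply, Matrix.mul_apply]
    rw [Finset.sum_comm]
    refine Finset.sum_congr rfl fun y _ => ?_
    simp only [shiftDiag, Matrix.of_apply, ite_mul, zero_mul, Finset.sum_ite_eq',
      Finset.mem_univ, if_true, copies]
    -- The last factor wraps around, since addition in `Fin (K + 1)` is cyclic; it closes the walk
    -- formed by the other factors.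
    rw [Fin.prod_univ_castSucc]
    simp only [Fin.coeSucc_eq_succ, Fin.last_add_one]
    ring
  rw [h1, sum_walk ρ K fun a b => z a * ρ b a]
  simp only [Matrix.trace, Matrix.diag_apply, Matrix.diagonal_mul]
  simp only [pow_succ, Matrix.mul_apply, Finset.mul_sum]
  exact Finset.sum_congr rfl fun a _ => Finset.sum_congr rfl fun b _ => by ring

lemma shiftDiag_unitary (K : ℕ) {z : ι → ℂ} (hz : ∀ x, star (z x) * z x = 1) :
    (shiftDiag K z)ᴴ * shiftDiag K z = 1 := by
  ext y y'
  simp only [Matrix.mul_apply, Matrix.conjTranspose_apply, shiftDiag, Matrix.of_apply,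
    mul_ite, mul_zero, Finset.sum_ite_eq', Finset.mem_univ, if_true, Matrix.one_apply]
  by_cases h : y = y'
  · subst h; simpa using hz (y 0)
  · have h' : ¬ (fun t => y' (t + 1)) = fun t => y (t + 1) := by
      intro he
      apply h
      ext1 t
      have := congrFun he (t - 1)
      simpa using this.symm
    simp [h, h']

end QPCA

namespace QPCA

variable {ι : Type} [Fintype ι] [DecidableEq ι]

/-- In an eigenbasis the trace is ∑ λ_i^k ∑ z_x |U_xi|², and the inner sums have modulus at most 1
because the columns of U are unit vectors. -/
lemma norm_trace_diagonal_mul_pow_le {σ : Matrix ι ι ℂ} (hσ : σ.PosSemidef) {z : ι → ℂ}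
    (hz : ∀ x, ‖z x‖ ≤ 1) (k : ℕ) :
    ‖(Matrix.diagonal z * σ ^ k).trace‖ ≤ ∑ i, hσ.isHermitian.eigenvalues i ^ k := by
  set h := hσ.isHermitian
  set U : Matrix ι ι ℂ := (h.eigenvectorUnitary : Matrix ι ι ℂ) with hU
  have hUU : star U * U = 1 := Unitary.coe_star_mul_self h.eigenvectorUnitary
  set D : Matrix ι ι ℂ := Matrix.diagonal (fun i => (h.eigenvalues i : ℂ)) with hD
  have hspec : σ = U * D * star U := by
    have := h.spectral_theorem
    rw [Unitary.conjStarAlgAut_apply] at this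
    exact this
  have hpow : σ ^ k = U * D ^ k * star U := by
    induction k with
    | zero => simp [U]
    | succ k ih =>
      rw [pow_succ, ih]
      conv_lhs => rw [hspec]
      rw [pow_succ]
      simp only [Matrix.mul_assoc]
      rw [← Matrix.mul_assoc (star U) U, hUU, Matrix.one_mul]
  have htr : (Matrix.diagonal z * σ ^ k).trace =
      ∑ i, (h.eigenvalues i : ℂ) ^ k * ∑ x, z x * (star (U x i) * U x i) := by
    rw [hpow, ← Matrix.mul_assoc, Matrix.trace_mul_comm, ← Matrix.mul_assoc, ← Matrix.mul_assoc,
      hD, Matrix.diagonal_pow]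
    simp only [Matrix.trace, Matrix.diag_apply, Matrix.mul_diagonal, Pi.pow_apply]
    refine Finset.sum_congr rfl fun i _ => ?_
    rw [mul_comm, Matrix.mul_apply]
    congr 1
    refine Finset.sum_congr rfl fun x _ => ?_
    rw [Matrix.mul_diagonal, Matrix.star_apply]
    ring
  have hcol : ∀ i, ‖∑ x, z x * (star (U x i) * U x i)‖ ≤ 1 := by
    intro i
    have h1 : ∑ x, ‖U x i‖ ^ 2 = 1 := by
      have := congrFun (congrFun hUU i) i
      rw [Matrix.mul_apply, Matrix.one_apply_eq] at this
      have h2 : ∀ x, star U i x * U x i = ((‖U x i‖ ^ 2 : ℝ) : ℂ) := fun x => by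
        rw [Matrix.star_apply, mul_comm, RCLike.star_def, Complex.mul_conj,
          Complex.normSq_eq_norm_sq]
      simp_rw [h2] at this
      exact_mod_cast this
    rw [← h1]
    refine (norm_sum_le _ _).trans (Finset.sum_le_sum fun x _ => ?_)
    rw [norm_mul, norm_mul, norm_star, ← sq]
    exact mul_le_of_le_one_left (by positivity) (hz x)
  rw [htr]
  refine (norm_sum_le _ _).trans (Finset.sum_le_sum fun i _ => ?_)
  have h0 : 0 ≤ h.eigenvalues i := hσ.eigenvalues_nonneg i
  rw [norm_mul, norm_pow, Complex.norm_real, Real.norm_of_nonneg h0]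
  exact mul_le_of_le_one_right (by positivity) (hcol i)

/-- High powers of a state with a gap are dominated by the principal component. -/
lemma exists_trace_diagonal_mul_pow {δ : ℝ} (hδ0 : 0 ≤ δ) (hδ1 : δ ≤ 1) {ρ : Matrix ι ι ℂ}
    {φ : ι → ℂ} (hρ : IsDensityMatrix ρ) (hφ : IsPrincipalComponent δ ρ φ) :
    ∃ top : ℝ, δ ≤ top ∧ top ≤ 1 ∧ ∀ (z : ι → ℂ), (∀ x, ‖z x‖ ≤ 1) → ∀ k : ℕ,
      |(Matrix.diagonal z * ρ ^ (k + 1)).trace.re -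
        top ^ (k + 1) * expectation (Matrix.diagonal z) φ| ≤ (top - δ) ^ k := by
  obtain ⟨hunit, top, htop, hgap⟩ := hφ
  have hherm : ρᴴ = ρ := hρ.posSemidef.isHermitian
  set P : Matrix ι ι ℂ := Matrix.vecMulVec φ (star φ) with hP
  have hPH : Pᴴ = P := by rw [hP, Matrix.conjTranspose_vecMulVec, star_star]
  have hPP : P * P = P := by
    rw [hP, Matrix.vecMulVec_mul_vecMulVec, hunit, one_smul]
  have hρP : ρ * P = (top : ℂ) • P := by
    rw [hP, Matrix.mul_vecMulVec, htop, Matrix.smul_vecMulVec]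
  have hPρ : P * ρ = (top : ℂ) • P := by
    have := congrArg Matrix.conjTranspose hρP
    rwa [Matrix.conjTranspose_mul, Matrix.conjTranspose_smul, hPH, hherm, RCLike.star_def,
      Complex.conj_ofReal] at this
  -- The rest of the state after removing the principal component: positive, annihilated by `P`, of
  -- trace 1 - top.
  set σ : Matrix ι ι ℂ := ρ - (top : ℂ) • P with hσdef
  have hσP : σ * P = 0 := by rw [hσdef, sub_mul, hρP, smul_mul_assoc, hPP, sub_self]
  have hPσ : P * σ = 0 := by rw [hσdef, mul_sub, hPρ, mul_smul_comm, hPP, sub_self]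
  have hσ : σ.PosSemidef := by
    have h := hρ.posSemidef.mul_mul_conjTranspose_same (1 - P)
    have he : (1 - P) * ρ * (1 - P)ᴴ = σ := by
      rw [Matrix.conjTranspose_sub, Matrix.conjTranspose_one, hPH, sub_mul, one_mul, hPρ,
        ← hσdef, mul_sub, mul_one, hσP, sub_zero]
    rwa [he] at h
  have hpow : ∀ k : ℕ, ρ ^ (k + 1) = ((top : ℂ) ^ (k + 1)) • P + σ ^ (k + 1) := by
    intro k
    have hρ' : ρ = (top : ℂ) • P + σ := by rw [hσdef]; abel
    induction k with
    | zero => simpa using hρ'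
    | succ k ih =>
      rw [pow_succ, ih]
      conv_lhs => rw [hρ']
      rw [add_mul, mul_add, mul_add, smul_mul_smul_comm, hPP, smul_mul_assoc, hPσ,
        mul_smul_comm, pow_succ σ k, mul_assoc, hσP, pow_succ (top : ℂ) (k + 1)]
      simp [pow_succ, mul_assoc]
  have hPtr : P.trace = 1 := by
    rw [hP, Matrix.trace_vecMulVec, dotProduct_comm, hunit]
  set h := hσ.isHermitian
  have hsum : ∑ i, h.eigenvalues i = 1 - top := by
    have h1 := h.trace_eq_sum_eigenvalues
    have h3 : σ.trace = 1 - (top : ℂ) • 1 := by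
      rw [hσdef, Matrix.trace_sub, hρ.trace_eq_one, Matrix.trace_smul, hPtr]
    rw [h3] at h1
    have h2 : ((∑ i, h.eigenvalues i : ℝ) : ℂ) = ((1 - top : ℝ) : ℂ) := by
      push_cast
      rw [smul_eq_mul, mul_one] at h1
      exact h1.symm
    exact_mod_cast h2
  have h0 : ∀ i, 0 ≤ h.eigenvalues i := hσ.eigenvalues_nonneg
  -- Only nonzero eigenvalues are usable: φ lies in the kernel of σ, so basis vectors of the kernel
  -- need not be orthogonal to φ.
  have hev : ∀ i, h.eigenvalues i ≠ 0 → h.eigenvalues i + δ ≤ top := by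
    intro i hi
    have hv := h.mulVec_eigenvectorBasis i
    set v : ι → ℂ := ⇑(h.eigenvectorBasis i) with hvdef
    have hv0 : v ≠ 0 := by
      intro hv0
      have := h.eigenvectorBasis.orthonormal.ne_zero i
      apply this
      ext x
      exact congrFun hv0 x
    have hPv : P *ᵥ v = 0 := by
      have h1 : P *ᵥ (σ *ᵥ v) = 0 := by rw [Matrix.mulVec_mulVec, hPσ, Matrix.zero_mulVec]
      rw [hv, Matrix.mulVec_smul] at h1
      exact (smul_eq_zero.1 h1).resolve_left hi
    refine hgap _ v hv0 ?_ ?_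
    · rw [hP, Matrix.vecMulVec_mulVec] at hPv
      have h2 := congrArg (fun w => star φ ⬝ᵥ w) hPv
      simpa [hunit] using h2
    · have : ρ = σ + (top : ℂ) • P := by rw [hσdef]; abel
      rw [this, Matrix.add_mulVec, Matrix.smul_mulVec, hPv, smul_zero, add_zero, hv]
      rfl
  have htop1 : top ≤ 1 := by
    have := Finset.sum_nonneg fun i (_ : i ∈ Finset.univ) => h0 i
    linarith
  have hδtop : δ ≤ top := by
    -- If σ has no nonzero eigenvalue, `hev` says nothing, but then top = 1 and δ ≤ 1 suffices.
    by_cases hall : ∀ i, h.eigenvalues i = 0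
    · simp only [hall, Finset.sum_const_zero] at hsum
      linarith
    · push Not at hall
      obtain ⟨i, hi⟩ := hall
      linarith [hev i hi, h0 i]
  refine ⟨top, hδtop, htop1, fun z hz k => ?_⟩
  have hmain : (Matrix.diagonal z * ρ ^ (k + 1)).trace.re -
      top ^ (k + 1) * expectation (Matrix.diagonal z) φ =
        (Matrix.diagonal z * σ ^ (k + 1)).trace.re := by
    rw [hpow, mul_add, mul_smul_comm, Matrix.trace_add, Matrix.trace_smul, hP,
      Matrix.mul_vecMulVec, Matrix.trace_vecMulVec, dotProduct_comm, smul_eq_mul,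
      ← Complex.ofReal_pow, Complex.add_re, Complex.re_ofReal_mul]
    simp [expectation]
  rw [hmain]
  refine (Complex.abs_re_le_norm _).trans ((norm_trace_diagonal_mul_pow_le hσ hz _).trans ?_)
  have hle : ∀ i, h.eigenvalues i ^ (k + 1) ≤ (top - δ) ^ k * h.eigenvalues i := by
    intro i
    rw [pow_succ]
    by_cases hi : h.eigenvalues i = 0
    · simp [hi]
    · exact mul_le_mul_of_nonneg_right
        (pow_le_pow_left₀ (h0 i) (by linarith [hev i hi]) k) (h0 i)
  refine (Finset.sum_le_sum fun i _ => hle i).trans ?_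
  rw [← Finset.mul_sum, hsum]
  have hpk : 0 ≤ (top - δ) ^ k := pow_nonneg (by linarith) k
  exact mul_le_of_le_one_right hpk (by linarith)

end QPCA

namespace QPCA

/-! ### Measuring the real part of the expectation of a unitary -/

section PhaseMeasurement

variable {X : Type} [Fintype X] [DecidableEq X]

/-- The two signs. -/
def sgn (b : Fin 2) : ℝ := if b = 0 then 1 else -1

lemma sgn_mul_self (b : Fin 2) : sgn b * sgn b = 1 := by
  unfold sgn; split_ifs <;> norm_num

/-- A random choice between measuring the Hermitian parts of two unitaries. -/
noncomputable def phaseEffect (W : Fin 2 → Matrix X X ℂ) (ω : Fin 2 × Fin 2) : Matrix X X ℂ :=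
  (1 / 8 : ℂ) • ((1 + (sgn ω.2 : ℂ) • W ω.1)ᴴ * (1 + (sgn ω.2 : ℂ) • W ω.1))

variable {W : Fin 2 → Matrix X X ℂ}

lemma phaseEffect_posSemidef (ω : Fin 2 × Fin 2) : (phaseEffect W ω).PosSemidef := by
  refine (Matrix.posSemidef_conjTranspose_mul_self _).smul ?_
  rw [show (1 / 8 : ℂ) = ((1 / 8 : ℝ) : ℂ) by norm_num, Complex.zero_le_real]; norm_num

/-- Unitarity reduces the square to 2 ± (W + Wᴴ). The prefactor 1/8 is 1/2 for the choice of the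
unitary times 1/4 for normalizing the two-outcome test. -/
lemma phaseEffect_eq (hW : ∀ i, (W i)ᴴ * W i = 1) (ω : Fin 2 × Fin 2) :
    phaseEffect W ω =
      (1 / 4 : ℂ) • (1 : Matrix X X ℂ) + ((sgn ω.2 : ℂ) / 8) • (W ω.1 + (W ω.1)ᴴ) := by
  have hs : (sgn ω.2 : ℂ) * sgn ω.2 = 1 := by exact_mod_cast sgn_mul_self ω.2
  rw [phaseEffect, Matrix.conjTranspose_add, Matrix.conjTranspose_one, Matrix.conjTranspose_smul,
    RCLike.star_def, Complex.conj_ofReal, add_mul, mul_add, mul_add, smul_mul_smul_comm, hW, hs]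
  simp only [one_mul, mul_one]
  module

lemma sum_phaseEffect (hW : ∀ i, (W i)ᴴ * W i = 1) : ∑ ω, phaseEffect W ω = 1 := by
  simp_rw [phaseEffect_eq hW, Fintype.sum_prod_type, Fin.sum_univ_two, sgn]
  simp only [if_true, one_ne_zero, if_false]
  push_cast
  module

lemma re_trace_phaseEffect_mul (hW : ∀ i, (W i)ᴴ * W i = 1) {R : Matrix X X ℂ} (hR : Rᴴ = R)
    (hR1 : R.trace = 1) (ω : Fin 2 × Fin 2) :
    (phaseEffect W ω * R).trace.re = 1 / 4 * (1 + sgn ω.2 * (W ω.1 * R).trace.re) := by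
  have h : ((W ω.1)ᴴ * R).trace.re = (W ω.1 * R).trace.re := by
    rw [← hR, ← Matrix.conjTranspose_mul, Matrix.trace_conjTranspose, hR, Matrix.trace_mul_comm]
    simp
  rw [phaseEffect_eq hW, add_mul, smul_mul_assoc, smul_mul_assoc, one_mul, add_mul,
    Matrix.trace_add, Matrix.trace_smul, Matrix.trace_smul, Matrix.trace_add, hR1]
  rw [show (1 / 4 : ℂ) = ((1 / 4 : ℝ) : ℂ) by norm_num,
    show (sgn ω.2 : ℂ) / 8 = ((sgn ω.2 / 8 : ℝ) : ℂ) by push_cast; rfl]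
  simp only [smul_eq_mul, Complex.add_re, Complex.re_ofReal_mul, h, Complex.one_re]
  ring

/-- The unbiased estimator of the Hermitian part of the unitary `i`. -/
def phaseValue (i : Fin 2) (ω : Fin 2 × Fin 2) : ℝ := if ω.1 = i then 2 * sgn ω.2 else 0

lemma sum_phaseEffect_mul_phaseValue (hW : ∀ i, (W i)ᴴ * W i = 1) {R : Matrix X X ℂ}
    (hR : Rᴴ = R) (hR1 : R.trace = 1) (i : Fin 2) :
    ∑ ω, (phaseEffect W ω * R).trace.re * phaseValue i ω = (W i * R).trace.re := by
  simp_rw [re_trace_phaseEffect_mul hW hR hR1, phaseValue, Fintype.sum_prod_type]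
  fin_cases i <;> simp [Fin.sum_univ_two, sgn] <;> ring

/-- Each unitary is chosen with probability 1/2, and the value is then ±2, so the second moment does
not depend on the state. -/
lemma sum_phaseEffect_mul_phaseValue_sq (hW : ∀ i, (W i)ᴴ * W i = 1) {R : Matrix X X ℂ}
    (hR : Rᴴ = R) (hR1 : R.trace = 1) (i : Fin 2) :
    ∑ ω, (phaseEffect W ω * R).trace.re * phaseValue i ω ^ 2 = 2 := by
  simp_rw [re_trace_phaseEffect_mul hW hR hR1, phaseValue, Fintype.sum_prod_type]
  fin_cases i <;> simp [Fin.sum_univ_two, sgn] <;> ring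

end PhaseMeasurement

/-! ### The quantum-enhanced estimator -/

lemma IsPrincipalComponent.mono {ι : Type} [Fintype ι] {δ δ' : ℝ} (h : δ' ≤ δ)
    {ρ : Matrix ι ι ℂ} {φ : ι → ℂ} (hφ : IsPrincipalComponent δ ρ φ) :
    IsPrincipalComponent δ' ρ φ := by
  obtain ⟨h1, top, h2, h3⟩ := hφ
  exact ⟨h1, top, h2, fun μ v hv h4 h5 => by linarith [h3 μ v hv h4 h5]⟩

variable {ι : Type} [Fintype ι] [DecidableEq ι]

lemma abs_expectation_diagonal_le {φ : ι → ℂ} (hφ : star φ ⬝ᵥ φ = 1) {z : ι → ℂ}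
    (hz : ∀ x, ‖z x‖ ≤ 1) : |expectation (Matrix.diagonal z) φ| ≤ 1 := by
  have h1 : ∑ x, ‖φ x‖ ^ 2 = 1 := by
    have h2 : ∀ x, star φ x * φ x = ((‖φ x‖ ^ 2 : ℝ) : ℂ) := fun x => by
      rw [Pi.star_apply, mul_comm, RCLike.star_def, Complex.mul_conj, Complex.normSq_eq_norm_sq]
    rw [dotProduct] at hφ
    simp_rw [h2] at hφ
    exact_mod_cast hφ
  refine (Complex.abs_re_le_norm _).trans ?_
  rw [dotProduct, ← h1]
  refine (norm_sum_le _ _).trans (Finset.sum_le_sum fun x _ => ?_)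
  rw [Matrix.mulVec_diagonal, Pi.star_apply, norm_mul, norm_mul, norm_star]
  nlinarith [mul_le_mul_of_nonneg_right (hz x) (sq_nonneg ‖φ x‖)]

/-- The error is ((b - Le) - e(a - L))/a, at most (L/5)/(9L/10) = 2/9 in modulus. -/
lemma abs_div_sub_le {L e a b : ℝ} (hL : 0 < L) (he : |e| ≤ 1) (ha : |a - L| ≤ L / 10)
    (hb : |b - L * e| ≤ L / 10) : |b / a - e| ≤ 0.25 := by
  have ha' := abs_le.1 ha
  have hapos : 0 < a := by linarith
  have h1 : b / a - e = ((b - L * e) - e * (a - L)) / a := by field_simp; ring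
  rw [h1, abs_div, abs_of_pos hapos, div_le_iff₀ hapos]
  have h2 : |e * (a - L)| ≤ L / 10 := by
    rw [abs_mul]
    exact (mul_le_of_le_one_left (abs_nonneg _) he).trans ha
  have h3 := abs_sub (b - L * e) (e * (a - L))
  linarith

/-- A constant number of copies, depending on the gap only, suffices to predict the expectation
value of a diagonal observable with eigenvalues of modulus one. -/
lemma exists_copies_quantumEnhanced {δ : ℝ} (hδ : 0 < δ) :
    ∃ T : ℕ, ∀ (ι : Type) [Fintype ι] [DecidableEq ι] (z : ι → ℂ), (∀ x, star (z x) * z x = 1) →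
      ∃ A : QuantumEnhancedAlgorithm ι T,
        PredictsPrincipalComponent (Matrix.diagonal z) δ fun ρ S => A.outputProb ρ S := by
  -- Truncation keeps 1 - γ nonnegative; lowering the gap only weakens the assumption on the state.
  set γ : ℝ := min δ 1 with hγ
  have hγ0 : 0 < γ := lt_min hδ one_pos
  have hγ1 : γ ≤ 1 := min_le_right _ _
  obtain ⟨K, hK⟩ := exists_pow_lt_of_lt_one (show 0 < γ / 20 by positivity)
    (show 1 - γ < 1 by linarith)
  set ε : ℝ := γ ^ (K + 1) / 20 with hε
  have hε0 : 0 < ε := by positivity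
  -- Chebyshev with second moment 2 then bounds the failure of each of the two averages by 2/(m ε²)
  -- ≤ 1/10.
  obtain ⟨m, hm⟩ := exists_nat_ge (20 / ε ^ 2)
  have hmR : (0 : ℝ) < m := lt_of_lt_of_le (by positivity) hm
  have hm0 : 0 < m := by exact_mod_cast hmR
  refine ⟨m * (K + 1), fun ι _ _ z hz => ?_⟩
  have hznorm : ∀ x, ‖z x‖ ≤ 1 := fun x => by
    have h := congrArg norm (hz x)
    rw [norm_mul, norm_star, norm_one] at h
    nlinarith [norm_nonneg (z x)]
  -- `W 0` is the bare shift, which estimates the denominator tr(ρ^(K+1)); `W 1` carries the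
  -- observable and estimates the numerator.
  set W : Fin 2 → Matrix (Fin (K + 1) → ι) (Fin (K + 1) → ι) ℂ :=
    fun i => shiftDiag K (if i = 0 then 1 else z) with hWdef
  have hW : ∀ i, (W i)ᴴ * W i = 1 := by
    intro i
    refine shiftDiag_unitary K fun x => ?_
    split_ifs
    · simp
    · exact hz x
  obtain ⟨A, hA⟩ := exists_quantumEnhancedAlgorithm (phaseEffect_posSemidef (W := W))
    (sum_phaseEffect hW) m
    fun s => ((∑ j, phaseValue 1 (s j)) / m) / ((∑ j, phaseValue 0 (s j)) / m)
  refine ⟨A, fun ρ φ hρ hφ => ?_⟩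
  obtain ⟨top, hγtop, htop1, hpow⟩ := exists_trace_diagonal_mul_pow hγ0.le hγ1 hρ
    (hφ.mono (min_le_left _ _))
  have htop0 : 0 < top := hγ0.trans_le hγtop
  set L := top ^ (K + 1) with hL
  have hL0 : 0 < L := by positivity
  have herr : (top - γ) ^ K ≤ L / 20 := by
    -- This uses top ≤ 1; it makes the error small relative to top^(K+1), which may itself be tiny.
    have h1 : top - γ ≤ top * (1 - γ) := by nlinarith
    calc (top - γ) ^ K ≤ (top * (1 - γ)) ^ K := pow_le_pow_left₀ (by linarith) h1 K
      _ = top ^ K * (1 - γ) ^ K := mul_pow _ _ _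
      _ ≤ top ^ K * (top / 20) := by
        refine mul_le_mul_of_nonneg_left ?_ (by positivity)
        linarith
      _ = L / 20 := by rw [hL, pow_succ]; ring
  have hεL : ε ≤ L / 20 := by
    rw [hε, hL]
    have := pow_le_pow_left₀ hγ0.le hγtop (K + 1)
    linarith
  set e := expectation (Matrix.diagonal z) φ with he
  have he1 : |e| ≤ 1 := abs_expectation_diagonal_le hφ.1 hznorm
  set R := copies (K + 1) ρ with hRdef
  have hR : R.PosSemidef := copies_posSemidef hρ.posSemidef
  have hR1 : R.trace = 1 := by rw [hRdef, trace_copies, hρ.trace_eq_one, one_pow]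
  set p : Fin 2 × Fin 2 → ℝ := fun ω => (phaseEffect W ω * R).trace.re with hp
  have hp0 : ∀ ω, 0 ≤ p ω := fun ω => re_trace_mul_nonneg (phaseEffect_posSemidef ω) hR
  have hp1 : ∑ ω, p ω = 1 := by
    simp only [hp]
    rw [← Complex.re_sum, ← Matrix.trace_sum, ← Finset.sum_mul, sum_phaseEffect hW,
      Matrix.one_mul, hR1, Complex.one_re]
  set μ : Fin 2 → ℝ := fun i => ∑ ω, p ω * phaseValue i ω with hμ
  have hμW : ∀ i, μ i = (W i * R).trace.re :=
    sum_phaseEffect_mul_phaseValue hW hR.isHermitian hR1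
  have hμ0 : |μ 0 - L| ≤ L / 20 := by
    have h := (hpow 1 (fun x => by simp) K).trans herr
    have h1 : expectation (Matrix.diagonal (1 : ι → ℂ)) φ = 1 := by
      rw [Matrix.diagonal_one', expectation, Matrix.one_mulVec, hφ.1, Complex.one_re]
    rw [h1, mul_one] at h
    rw [hμW, hWdef, hRdef]
    simp only [if_true]
    rwa [trace_shiftDiag_mul_copies]
  have hμ1 : |μ 1 - L * e| ≤ L / 20 := by
    have h := (hpow z hznorm K).trans herr
    rw [hμW, hWdef, hRdef]
    simp only [one_ne_zero, if_false]
    rwa [trace_shiftDiag_mul_copies]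
  set B : Fin 2 → (Fin m → Fin 2 × Fin 2) → ℝ := fun i s =>
    {t : ℝ | ε < |t - μ i|}.indicator (fun _ => 1) ((∑ j, phaseValue i (s j)) / m) with hB
  have hbad : ∀ i, ∑ s : Fin m → Fin 2 × Fin 2, (∏ j, p (s j)) * B i s ≤ 1 / 10 := by
    intro i
    refine (sum_prod_mul_indicator_le hp0 hp1 (phaseValue i)
      (sum_phaseEffect_mul_phaseValue_sq hW hR.isHermitian hR1 i).le hm0 hε0).trans ?_
    rw [div_le_iff₀ (by positivity)]
    rw [div_le_iff₀ (by positivity)] at hm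
    linarith
  refine le_of_le_of_eq ?_ (hA ρ hρ.posSemidef _).symm
  -- Union bound in pointwise form: if neither average deviates by more than ε ≤ L/20, each is
  -- within L/10 of its target and the ratio is accurate.
  have hpt : ∀ s : Fin m → Fin 2 × Fin 2,
      (∏ j, p (s j)) * (1 - B 0 s - B 1 s) ≤ (∏ j, p (s j)) *
        {y : ℝ | |y - e| ≤ 0.25}.indicator (fun _ => 1)
          (((∑ j, phaseValue 1 (s j)) / m) / ((∑ j, phaseValue 0 (s j)) / m)) := by
    intro s
    refine mul_le_mul_of_nonneg_left ?_ (Finset.prod_nonneg fun j _ => hp0 _)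
    have hBnn : ∀ i, 0 ≤ B i s := fun i => Set.indicator_nonneg (fun _ _ => zero_le_one) _
    have hind : (0 : ℝ) ≤ {y : ℝ | |y - e| ≤ 0.25}.indicator (fun _ => 1)
        (((∑ j, phaseValue 1 (s j)) / m) / ((∑ j, phaseValue 0 (s j)) / m)) :=
      Set.indicator_nonneg (fun _ _ => zero_le_one) _
    have hB1 : ∀ i, ε < |(∑ j, phaseValue i (s j)) / m - μ i| → B i s = 1 :=
      fun i hi => Set.indicator_of_mem (s := {t : ℝ | ε < |t - μ i|}) hi _
    by_cases h0 : ε < |(∑ j, phaseValue 0 (s j)) / m - μ 0|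
    · linarith [hB1 0 h0, hBnn 1]
    by_cases h1 : ε < |(∑ j, phaseValue 1 (s j)) / m - μ 1|
    · linarith [hB1 1 h1, hBnn 0]
    rw [not_lt] at h0 h1
    have hgood : |((∑ j, phaseValue 1 (s j)) / m) / ((∑ j, phaseValue 0 (s j)) / m) - e| ≤ 0.25 :=
      abs_div_sub_le hL0 he1
        ((abs_sub_le _ (μ 0) _).trans (by linarith))
        ((abs_sub_le _ (μ 1) _).trans (by linarith))
    rw [Set.indicator_of_mem (s := {y : ℝ | |y - e| ≤ 0.25}) hgood]
    linarith [hBnn 0, hBnn 1]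
  refine le_trans ?_ (Finset.sum_le_sum fun s _ => hpt s)
  simp_rw [mul_sub, mul_one]
  rw [Finset.sum_sub_distrib, Finset.sum_sub_distrib, sum_prod_eq_one hp1]
  have := hbad 0
  have := hbad 1
  norm_num
  linarith

end QPCA

theorem mainTheorem2 :
    -- quantum-enhanced upper bound: a number of copies that does not depend on `n`
    (∀ δ : ℝ, 0 < δ → ∃ T : ℕ, ∀ (n : ℕ) (hn : 1 < n),
      ∃ A : QPCA.QuantumEnhancedAlgorithm (QPCA.Qubits n) T,
        QPCA.PredictsPrincipalComponent (QPCA.pauliZ (⟨0, by omega⟩ : Fin n)) δ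
          (fun ρ S => A.outputProb ρ S)) ∧
    -- conventional lower bound
    (∃ c : ℝ, 0 < c ∧ ∀ δ : ℝ, 0 < δ → δ < 1 / 2 → ∃ n₀ : ℕ, ∀ (n : ℕ) (hn : 1 < n), n₀ ≤ n →
      ∀ (T : ℕ) (A : QPCA.ConventionalAlgorithm (QPCA.Qubits n) T),
        QPCA.PredictsPrincipalComponent (QPCA.pauliZ (⟨0, by omega⟩ : Fin n)) δ
          (fun ρ S => A.outputProb ρ S) →
        c * (2 : ℝ) ^ ((n : ℝ) / 2) ≤ (T : ℝ)) := by
  obtain ⟨c, hc, hlower⟩ := QPCA.conventional_lower_bound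
  refine ⟨fun δ hδ => ?_, c, hc, fun δ h0 h1 => ?_⟩
  swap
  · obtain ⟨n₀, hn₀⟩ := hlower δ h0 h1
    exact ⟨n₀, fun n _ hle => hn₀ n _ hle⟩
  obtain ⟨T, hT⟩ := QPCA.exists_copies_quantumEnhanced hδ
  refine ⟨T, fun n hn => hT (QPCA.Qubits n) _ fun x => ?_⟩
  split_ifs <;> simp
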